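/- Let $U=U(\mathfrak{sl}(3))$ over $\mathbb C$ and let $\Gamma\subset U$ be the Gelfand-Tsetlin subalgebra, generated by the images $c_{mk}$ ($1\le k\le m\le 3$) of $\sum_{i_1,\dots,i_k\le m}E_{i_1i_2}\cdots E_{i_ki_1}$ under the projection $\mathfrak{gl}(3)\to\mathfrak{sl}(3)$. A Gelfand-Tsetlin module is a finitely generated $U$-module which is the direct sum of its generalized $\Gamma$-weight spaces. Let $v=(v_{31},v_{32},v_{33}\,|\,v_{21},v_{22}\,|\,v_{11})\in\mathbb C^6$ with $v_{31}+v_{32}+v_{33}+3=0$ and either $v_{21}-v_{22}\notin\mathbb Z$ or $v_{21}=v_{22}$, and let $V(T(v))$ be the (generic, respectively $1$-singular) universal tableaux module with basis $\mathrm{Tab}(w)$, $w=(m,n,k)\in\mathbb Z^3$. If $v_{21}-v_{22}\notin\mathbb Z$, then $\mathrm{Tab}(w)=T(v+w)$, and with $u=v+w=(u_{ij})$, where $m,n,k$ are added to $v_{21},v_{22},v_{11}$, the action is given by the Gelfand-Tsetlin formulas $$E_{21}T(u)=T(u-\delta^{11}),\qquad E_{12}T(u)=-(u_{21}-u_{11})(u_{22}-u_{11})T(u+\delta^{11}),$$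 $$E_{32}T(u)=\tfrac{u_{21}-u_{11}}{u_{21}-u_{22}}T(u-\delta^{21})-\tfrac{u_{22}-u_{11}}{u_{21}-u_{22}}T(u-\delta^{22}),$$ $$E_{23}T(u)=\tfrac{\prod_i(v_{3i}-u_{21})}{u_{21}-u_{22}}T(u+\delta^{21})-\tfrac{\prod_i(v_{3i}-u_{22})}{u_{21}-u_{22}}T(u+\delta^{22}),$$ $$H_1T(u)=(2u_{11}-u_{21}-u_{22}-1)T(u),\qquad H_2T(u)=(2(u_{21}+u_{22}+1)-u_{11})T(u).$$ If $v_{21}=v_{22}$, then $\mathrm{Tab}(w)=T(v+w)$ for $m\le n$ and $\mathrm{Tab}(w)=\mathcal DT(v+w)$ for $m>n$, with $T(v+w)=T(v+\tau w)$, $\mathcal DT(v+w)=-\mathcal DT(v+\tau w)$, $\tau(m,n,k)=(n,m,k)$; the action of these generators $E$ is $E\,T(v+w)=\mathcal D^{v}((v_{21}-v_{22})E\,T(v+w))$ and, for $m\ne n$, $E\,\mathcal DT(v+w)=\mathcal D^{v}(E\,T(v+w))$, where $E\,T(v+w)$ on the right is expanded by the formulas above and $\mathcal D^v(fT(v+z))=\mathcal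 D^v(f)T(v+z)+f(v)\mathcal DT(v+z)$ with $\mathcal D^v(f)=\frac12(\partial_{v_{21}}f-\partial_{v_{22}}f)(v)$. For $\mathcal B\subset\mathbb Z^3$, $M(\mathcal B;v)$ denotes the Gelfand-Tsetlin module which is the subquotient of $V(T(v))$ with basis $\{\mathrm{Tab}(w)\mid w\in\mathcal B\}$ (if there is such a subquotient, i.e. if $\mathcal B=S_1\setminus S_2$ for two sets $S_1,S_2$ such that $\mathrm{Tab}(S_1)$ and $\mathrm{Tab}(S_2)$ span submodules), and $L(\mathcal B;v)$ stands for $M(\mathcal B;v)$ if it is simple. Write $\mathcal B+\mathbb N\delta^{11}=\{(m,n,k+t)\mid (m,n,k)\in\mathcal B,\ t\ge 0\}$. Let $\mathcal D_{12}U$ be the Ore localization of $U$ at the powers of $f=E_{21}$. For a $U$-module $L$ let $\mathcal D_{12}L$ be its localization, and let $\mathcal D_{12}^xL$ ($x\in\mathbb C$) be the twisted localization, i.e. the space of the symbols $y^x$, $y\in \mathcal D_{12}L$, on which $u\in\mathcal D_{12}U$ acts by $u\cdot y^x=(\Theta_x(u)y)^x$, $\Theta_x(u)=\sum_{i\ge0}\binom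 xi(\mathrm{ad} f)^i(u)f^{-i}$. If $f$ acts injectively on $L$, so that $L\subset\mathcal D_{12}L$, put $\mathcal{QD}_{12}L=\mathcal D_{12}L/L$; and if the subspace $L^x=\{l^x\mid l\in L\}$ is a $U$-submodule of $\mathcal D^x_{12}L$, put $\mathcal{QD}^x_{12}L=\mathcal D^x_{12}L/L^x$. **Proposition.** Let $L=L(\mathcal B;v)$ be a simple Gelfand-Tsetlin module on which $E_{21}$ acts injectively. Then: 1. For every $x\in\mathbb C$ the module $M(\mathcal B+\mathbb N\delta^{11};\,v+x\delta^{11})$ exists and $\mathcal D_{12}^xL\simeq M(\mathcal B+\mathbb N\delta^{11};\,v+x\delta^{11})$, by an isomorphism that sends $\mathrm{Tab}(w)^x$ to $\mathrm{Tab}(w)$ for $w\in\mathcal B$. 2. For every $x\in\mathbb C$ for which $\mathcal{QD}^x_{12}L$ is defined (that is, $L^x$ is a submodule; for example $x=0$), the module $M((\mathcal B+\mathbb N\delta^{11})\setminus\mathcal B;\,v+x\delta^{11})$ exists, and the isomorphism of 1 induces $\mathcal{QD}_{12}^xL\simeq M((\mathcal B+\mathbb N\delta^{11})\setminus\mathcal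 B;\,v+x\delta^{11})$. 3. If $x=n$ is an integer, then $\mathcal D_{12}^{n}L\simeq\mathcal D_{12}L$ as $\mathcal D_{12}U$-modules through $y^n\mapsto f^{-n}y$. Moreover $\mathcal D_{12}L\simeq M(\mathcal B+\mathbb N\delta^{11};v)$, by an isomorphism that is $\mathrm{Tab}(w)\mapsto\mathrm{Tab}(w)$ on $L$, and it induces $\mathcal{QD}_{12}L\simeq M((\mathcal B+\mathbb N\delta^{11})\setminus\mathcal B;v)$. -/

import Mathlib

noncomputable section

namespace GTsl3

/-! ## Locally nilpotent `ad f`, Ore condition, and the twist `Θ_x` -/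

section General

variable {R : Type*} [Ring R] [Algebra ℂ R]

/-- `ad f : u ↦ f u - u f`. -/
def adE (f : R) : R →ₗ[ℂ] R := LinearMap.mulLeft ℂ f - LinearMap.mulRight ℂ f

theorem adE_apply (f u : R) : adE f u = f * u - u * f := rfl

theorem adE_mul (f u w : R) : adE f (u * w) = adE f u * w + u * adE f w := by
  simp only [adE_apply]; noncomm_ring

theorem adE_pow_of_le {f u : R} {n m : ℕ} (h : (adE f ^ n) u = 0) (hnm : n ≤ m) :
    (adE f ^ m) u = 0 := by
  obtain ⟨k, rfl⟩ := Nat.exists_eq_add_of_le hnm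
  rw [add_comm, pow_add, Module.End.mul_apply, h, map_zero]

theorem adE_nilp_mul (f : R) : ∀ (n m : ℕ) (u w : R), (adE f ^ n) u = 0 → (adE f ^ m) w = 0 →
    (adE f ^ (n + m)) (u * w) = 0 := by
  suffices H : ∀ (k n m : ℕ) (u w : R), n + m = k → (adE f ^ n) u = 0 → (adE f ^ m) w = 0 →
      (adE f ^ k) (u * w) = 0 from fun n m u w => H _ n m u w rfl
  intro k
  induction k with
  | zero =>
    intro n m u w h hu hw
    obtain ⟨rfl, rfl⟩ : n = 0 ∧ m = 0 := by omega
    have : u = 0 := by simpa using hu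
    simp [this]
  | succ k ih =>
    intro n m u w h hu hw
    rw [pow_succ, Module.End.mul_apply, adE_mul, map_add]
    rcases n with _ | n
    · have : u = 0 := by simpa using hu
      simp [this]
    rcases m with _ | m
    · have : w = 0 := by simpa using hw
      simp [this]
    rw [ih n (m + 1) (adE f u) w (by omega) (by rwa [pow_succ] at hu) hw,
      ih (n + 1) m u (adE f w) (by omega) hu (by rwa [pow_succ] at hw), add_zero]

/-- The subalgebra of elements on which `ad f` is nilpotent. -/
def adNilp (f : R) : Subalgebra ℂ R where
  carrier := {u | ∃ n, (adE f ^ n) u = 0}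
  mul_mem' := by
    rintro a b ⟨n, hn⟩ ⟨m, hm⟩
    exact ⟨n + m, adE_nilp_mul f n m a b hn hm⟩
  add_mem' := by
    rintro a b ⟨n, hn⟩ ⟨m, hm⟩
    exact ⟨max n m, by rw [map_add, adE_pow_of_le hn (le_max_left _ _),
      adE_pow_of_le hm (le_max_right _ _), add_zero]⟩
  algebraMap_mem' := fun c => ⟨1, by simp [adE_apply, Algebra.commutes]⟩

theorem pow_mul_ore (f : R) : ∀ (n : ℕ) (u : R), (adE f ^ n) u = 0 → ∀ k : ℕ,
    ∃ (r : R), f ^ (n + k) * u = r * f ^ k := by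
  intro n
  induction n with
  | zero => intro u h k; exact ⟨0, by have : u = 0 := by simpa using h
                                      simp [this]⟩
  | succ n ih => 
    intro u h k
    induction k with
    | zero => exact ⟨f ^ (n + 1) * u, by simp⟩
    | succ k ihk =>
      obtain ⟨r, hr⟩ := ihk
      obtain ⟨r', hr'⟩ := ih (adE f u) (by rwa [pow_succ] at h) (k + 1)
      refine ⟨r + r', ?_⟩
      have : f ^ (n + 1 + (k + 1)) * u = (f ^ (n + 1 + k) * u) * f + f ^ (n + (k+1)) * adE f u := by
        rw [adE_apply, show n + 1 + (k+1) = (n + (k+1)) + 1 by ring, show n + 1 + k = n + (k+1) by ring, pow_succ]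
        noncomm_ring
      rw [this, hr, hr', add_mul, mul_assoc, ← pow_succ]

theorem adE_mul_pow (f u : R) (k : ℕ) : adE f (u * f ^ k) = adE f u * f ^ k := by
  rw [adE_mul]
  have : adE f (f ^ k) = 0 := by rw [adE_apply, ← pow_succ, ← pow_succ', sub_self]
  rw [this, mul_zero, add_zero]

theorem pow_mul_eq_zero (f : R) (k : ℕ) : ∀ (n : ℕ) (u : R), (adE f ^ n) u = 0 → u * f ^ k = 0 →
    ∃ N : ℕ, f ^ N * u = 0 := by
  intro n
  induction n with
  | zero =>
    intro u h _
    have : u = 0 := by simpa using h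
    exact ⟨0, by simp [this]⟩
  | succ n ih =>
    intro u h h0
    obtain ⟨N, h1⟩ := ih (adE f u) (by rwa [pow_succ] at h) (by rw [← adE_mul_pow, h0, map_zero])
    have key : ∀ j : ℕ, f ^ (N + j) * u = f ^ N * u * f ^ j := by
      intro j
      induction j with
      | zero => simp
      | succ j ihj =>
        have h2 : f ^ (N + j) * adE f u = 0 := by
          rw [add_comm N j, pow_add, mul_assoc, h1, mul_zero]
        rw [adE_apply, mul_sub, sub_eq_zero] at h2
        rw [← add_assoc, pow_succ, mul_assoc, h2, ← mul_assoc, ihj, mul_assoc, ← pow_succ]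
    exact ⟨N + k, by rw [key, mul_assoc, h0, mul_zero]⟩

/-- If `ad f` is locally nilpotent, then the powers of `f` form an Ore set. -/
theorem nonempty_oreSet (f : R) (hf : ∀ u : R, ∃ n, (adE f ^ n) u = 0) :
    Nonempty (OreLocalization.OreSet (Submonoid.powers f)) := by
  rw [OreLocalization.nonempty_oreSet_iff]
  constructor
  · rintro a b ⟨_, k, rfl⟩ h
    obtain ⟨n, hn⟩ := hf (a - b)
    obtain ⟨N, hN⟩ := pow_mul_eq_zero f k n (a - b) hn (by rw [sub_mul, sub_eq_zero]; exact h)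
    exact ⟨⟨f ^ N, N, rfl⟩, by rwa [mul_sub, sub_eq_zero] at hN⟩
  · rintro a ⟨_, k, rfl⟩
    obtain ⟨n, hn⟩ := hf a
    obtain ⟨r, hr⟩ := pow_mul_ore f n a hn k
    exact ⟨r, ⟨f ^ (n + k), n + k, rfl⟩, hr⟩

open Polynomial in
/-- The binomial coefficient `binom(x, i)` as a polynomial in `x`. -/
def binomPoly (i : ℕ) : ℂ[X] := C ((i.factorial : ℂ)⁻¹) * descPochhammer ℂ i

open Polynomial in
theorem binomPoly_eval (i : ℕ) (x : ℂ) : (binomPoly i).eval x = Ring.choose x i := by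
  have h := Ring.descPochhammer_eq_factorial_smul_choose x i
  have h2 : (descPochhammer ℂ i).eval x = (descPochhammer ℤ i).smeval x := by
    rw [← descPochhammer_map (algebraMap ℤ ℂ), eval_map_algebraMap, aeval_eq_smeval]
  rw [binomPoly, eval_C_mul, h2, h, nsmul_eq_mul, inv_mul_cancel_left₀]
  exact_mod_cast i.factorial_ne_zero

/-- `Θ_x(u) = ∑_{i ≥ 0} binom(x, i) (ad f)^i(u) f^{-i}`. -/
def thetaFun (f : Rˣ) (x : ℂ) (u : R) : R :=
  ∑ᶠ i : ℕ, Ring.choose x i • ((adE (f : R) ^ i) u * ((f⁻¹ : Rˣ) : R) ^ i)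

/-- `u ↦ (ad f)(u) f^{-1}`. -/
def thetaN (f : Rˣ) : R →ₗ[ℂ] R := LinearMap.mulRight ℂ ((f⁻¹ : Rˣ) : R) ∘ₗ adE (f : R)

theorem thetaN_apply (f : Rˣ) (u : R) : thetaN f u = f * u * ((f⁻¹ : Rˣ) : R) - u := by
  simp [thetaN, adE_apply, sub_mul, mul_assoc]

theorem thetaN_pow (f : Rˣ) (i : ℕ) (u : R) :
    (thetaN f ^ i) u = (adE (f : R) ^ i) u * ((f⁻¹ : Rˣ) : R) ^ i := by
  induction i with
  | zero => simp
  | succ i ih =>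
    rw [pow_succ', Module.End.mul_apply, ih, pow_succ' (adE (f : R)), Module.End.mul_apply]
    have hc : Commute (f : R) (((f⁻¹ : Rˣ) : R) ^ i) :=
      (show Commute (f : R) ((f⁻¹ : Rˣ) : R) by simp [Commute, SemiconjBy]).pow_right i
    simp only [thetaN, LinearMap.comp_apply, LinearMap.mulRight_apply, adE_apply]
    rw [mul_assoc _ _ (f : R), ← hc.eq, pow_succ]
    noncomm_ring

theorem thetaFun_eq_sum (f : Rˣ) (x : ℂ) {u : R} {n : ℕ} (h : (adE (f : R) ^ n) u = 0) :
    thetaFun f x u = ∑ i ∈ Finset.range n, Ring.choose x i • (thetaN f ^ i) u := by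
  unfold thetaFun
  simp only [← thetaN_pow]
  apply finsum_eq_sum_of_support_subset
  intro i hi
  by_contra hni
  apply hi
  have : n ≤ i := by simpa using hni
  simp only
  rw [thetaN_pow, adE_pow_of_le h this, zero_mul, smul_zero]

theorem thetaFun_natCast (f : Rˣ) (m : ℕ) {u : R} {n : ℕ} (h : (adE (f : R) ^ n) u = 0) :
    thetaFun f m u = (f : R) ^ m * u * ((f⁻¹ : Rˣ) : R) ^ m := by
  have h1 : ∀ k : ℕ, ((thetaN f + 1) ^ k) u = (f : R) ^ k * u * ((f⁻¹ : Rˣ) : R) ^ k := by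
    intro k
    induction k with
    | zero => simp
    | succ k ih =>
      rw [pow_succ', Module.End.mul_apply, ih, LinearMap.add_apply, thetaN_apply]
      simp only [Module.End.one_apply, sub_add_cancel]
      rw [pow_succ' (f : R), pow_succ ((f⁻¹ : Rˣ) : R)]
      noncomm_ring
  rw [← h1, (Commute.one_right (thetaN f)).add_pow]
  rw [thetaFun_eq_sum f m (adE_pow_of_le h (Nat.le_add_right n (m + 1)))]
  simp only [one_pow, mul_one, LinearMap.sum_apply, Ring.choose_natCast]
  symm
  apply Finset.sum_subset_zero_on_sdiff
  · intro i; simp; omega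
  · intro i hi
    have : m < i := by simp at hi; omega
    simp [Nat.choose_eq_zero_of_lt this]
  · intro i _
    rw [← nsmul_eq_mul', LinearMap.smul_apply, Nat.cast_smul_eq_nsmul]

theorem eq_zero_of_natCast {V : Type*} [AddCommGroup V] [Module ℂ V] (s : ℂ → V)
    (hp : ∀ φ : Module.Dual ℂ V, ∃ p : Polynomial ℂ, ∀ x, φ (s x) = p.eval x)
    (h0 : ∀ n : ℕ, s n = 0) (x : ℂ) : s x = 0 := by
  rw [← Module.forall_dual_apply_eq_zero_iff ℂ]
  intro φ
  obtain ⟨p, hp⟩ := hp φ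
  have : p = 0 := by
    apply Polynomial.eq_zero_of_infinite_isRoot
    apply (Set.infinite_range_of_injective (Nat.cast_injective (R := ℂ))).mono
    rintro _ ⟨n, rfl⟩
    simp [Polynomial.IsRoot, ← hp, h0]
  rw [hp, this, Polynomial.eval_zero]

theorem thetaFun_mul (f : Rˣ) (hf : ∀ u : R, ∃ n, (adE (f : R) ^ n) u = 0) (x : ℂ) (u w : R) :
    thetaFun f x (u * w) = thetaFun f x u * thetaFun f x w := by
  obtain ⟨a, ha⟩ := hf u
  obtain ⟨b, hb⟩ := hf w
  obtain ⟨c, hc⟩ := hf (u * w)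
  rw [← sub_eq_zero]
  refine eq_zero_of_natCast (fun x => thetaFun f x (u * w) - thetaFun f x u * thetaFun f x w)
    ?_ ?_ x
  · intro φ
    refine ⟨∑ i ∈ Finset.range c, binomPoly i * Polynomial.C (φ ((thetaN f ^ i) (u * w))) -
      ∑ i ∈ Finset.range a, ∑ j ∈ Finset.range b, binomPoly i * binomPoly j *
        Polynomial.C (φ ((thetaN f ^ i) u * (thetaN f ^ j) w)), fun x => ?_⟩
    rw [thetaFun_eq_sum f x ha, thetaFun_eq_sum f x hb, thetaFun_eq_sum f x hc]
    simp only [Polynomial.eval_sub, Polynomial.eval_finsetSum, Polynomial.eval_mul,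
      Polynomial.eval_C, binomPoly_eval, map_sub, map_sum, map_smul, Finset.sum_mul_sum,
      smul_mul_smul_comm, smul_eq_mul]
  · intro n
    rw [thetaFun_natCast f n ha, thetaFun_natCast f n hb, thetaFun_natCast f n hc, sub_eq_zero]
    have h1 : ((f⁻¹ : Rˣ) : R) ^ n * (f : R) ^ n = 1 := by
      rw [← Units.val_pow_eq_pow_val, ← Units.val_pow_eq_pow_val, ← Units.val_mul]; simp
    calc _ = (f : R) ^ n * u * 1 * w * ((f⁻¹ : Rˣ) : R) ^ n := by noncomm_ring
      _ = _ := by rw [← h1]; noncomm_ring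

/-- `Θ_x` as an algebra endomorphism. -/
def theta (f : Rˣ) (hf : ∀ u : R, ∃ n, (adE (f : R) ^ n) u = 0) (x : ℂ) : R →ₐ[ℂ] R where
  toFun := thetaFun f x
  map_one' := by
    rw [thetaFun_eq_sum f x (n := 1) (by simp [adE_apply])]; simp
  map_zero' := by
    rw [thetaFun_eq_sum f x (n := 0) (by simp)]; simp
  map_mul' := thetaFun_mul f hf x
  map_add' u w := by
    obtain ⟨a, ha⟩ := hf u
    obtain ⟨b, hb⟩ := hf w
    have ha' := adE_pow_of_le ha (le_max_left a b)
    have hb' := adE_pow_of_le hb (le_max_right a b)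
    rw [thetaFun_eq_sum f x ha', thetaFun_eq_sum f x hb', thetaFun_eq_sum f x (n := max a b)
      (by rw [map_add, ha', hb', add_zero]), ← Finset.sum_add_distrib]
    simp
  commutes' c := by
    rw [thetaFun_eq_sum f x (n := 1) (by simp [adE_apply, Algebra.commutes])]; simp


end General

/-! ## `U(sl(3))` and its Gelfand-Tsetlin subalgebra -/

/-- The Lie algebra `sl(3)` over `ℂ`. -/
abbrev sl3 := LieAlgebra.SpecialLinear.sl (Fin 3) ℂ

/-- The universal enveloping algebra of `sl(3)`. -/
abbrev U := UniversalEnvelopingAlgebra ℂ sl3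

/-- The image `E_{ij} - δ_{ij} I/3` of the elementary matrix `E_{ij}` under the projection
`A ↦ A - (tr A / 3) I` of `gl(3)` onto `sl(3)`. Indices start from `0`. -/
def slE (i j : Fin 3) : sl3 :=
  ⟨Matrix.single i j 1 - (if i = j then (1 / 3 : ℂ) else 0) • (1 : Matrix (Fin 3) (Fin 3) ℂ), by
    change Matrix.trace (Matrix.single i j 1 -
      (if i = j then (1 / 3 : ℂ) else 0) • (1 : Matrix (Fin 3) (Fin 3) ℂ)) = 0
    by_cases h : i = j
    · subst h
      simp [Matrix.trace_sub, Matrix.trace_smul]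
    · simp [h, Matrix.trace_single_eq_of_ne i j _ h]⟩

/-- The image of `E_{ij}` in `U(sl(3))`. -/
def E (i j : Fin 3) : U := UniversalEnvelopingAlgebra.ι ℂ (slE i j)

/-- The element `E_{21}`. -/
abbrev E21 : U := E 1 0

section AdNilpotent

attribute [local instance] LieRing.ofAssociativeRing

theorem adE_ι (y x : sl3) : adE (UniversalEnvelopingAlgebra.ι ℂ y)
    (UniversalEnvelopingAlgebra.ι ℂ x) = UniversalEnvelopingAlgebra.ι ℂ ⁅y, x⁆ := by
  rw [LieHom.map_lie]; rfl

theorem adE_E21_pow_three (x : sl3) : (adE E21 ^ 3) (UniversalEnvelopingAlgebra.ι ℂ x) = 0 := by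
  have h : ⁅slE 1 0, ⁅slE 1 0, ⁅slE 1 0, x⁆⁆⁆ = 0 := by
    apply Subtype.ext
    have h2 : (slE 1 0).val * (slE 1 0).val = 0 := by simp [slE]
    simp only [LieAlgebra.SpecialLinear.sl_bracket]
    generalize (slE 1 0).val = e at *
    generalize x.val = y
    have h3 : ∀ z, e * (e * z) = 0 := fun z => by rw [← mul_assoc, h2, zero_mul]
    simp only [mul_sub, sub_mul, mul_assoc, h2, h3, mul_zero]
    simp
  simp only [pow_succ', pow_zero, Module.End.mul_apply, mul_one]
  simp only [E21, E, adE_ι, h, map_zero]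

theorem adE_E21_nilp (u : U) : ∃ n, (adE E21 ^ n) u = 0 := by
  let S : Subalgebra ℂ U := adNilp E21
  let j : sl3 →ₗ⁅ℂ⁆ S :=
    { toFun := fun x => ⟨UniversalEnvelopingAlgebra.ι ℂ x, 3, adE_E21_pow_three x⟩
      map_add' := fun x y => Subtype.ext (map_add _ x y)
      map_smul' := fun c x => Subtype.ext (map_smul _ c x)
      map_lie' := fun {x y} => Subtype.ext (LieHom.map_lie _ x y) }
  have h : S.val.comp (UniversalEnvelopingAlgebra.lift ℂ j) = AlgHom.id ℂ U := by
    apply UniversalEnvelopingAlgebra.hom_ext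
    ext x
    change ((UniversalEnvelopingAlgebra.lift ℂ j) (UniversalEnvelopingAlgebra.ι ℂ x) : U) = _
    rw [UniversalEnvelopingAlgebra.lift_ι_apply]
    rfl
  have h2 : ((UniversalEnvelopingAlgebra.lift ℂ j) u : U) = u := DFunLike.congr_fun h u
  have h3 := ((UniversalEnvelopingAlgebra.lift ℂ j) u).2
  rw [h2] at h3
  exact h3

end AdNilpotent

/-- The element `c_{mk} = ∑ E_{i_1 i_2} E_{i_2 i_3} ⋯ E_{i_k i_1}`, the sum being over all
`(i_1, …, i_k) ∈ {1, …, m}^k`, projected to `U(sl(3))`. The second argument is `k - 1`. -/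
def gtGen (m k : ℕ) : U :=
  ∑ i : Fin (k + 1) → Fin 3 with ∀ j, (i j : ℕ) < m,
    (List.ofFn fun j : Fin (k + 1) => E (i j) (i (j + 1))).prod

/-- The Gelfand-Tsetlin subalgebra `Γ` of `U(sl(3))`, generated by `c_{mk}`,
`1 ≤ k ≤ m ≤ 3`. -/
def gtSubalgebra : Subalgebra ℂ U :=
  Algebra.adjoin ℂ {c | ∃ m k : ℕ, k < m ∧ m ≤ 3 ∧ c = gtGen m k}

/-- `M(χ)`: the vectors `y` such that for every `γ ∈ Γ` some power of `γ - χ(γ)` kills `y`. -/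
def gtSpace (M : Type*) [AddCommGroup M] [Module ℂ M] [Module U M] [IsScalarTower ℂ U M]
    (χ : gtSubalgebra →ₐ[ℂ] ℂ) : Submodule ℂ M :=
  ⨅ γ : gtSubalgebra, (Algebra.lsmul ℂ ℂ M (γ : U)).maxGenEigenspace (χ γ)

/-- A finitely generated `U`-module is a Gelfand-Tsetlin module if it is the direct sum of
the subspaces `M(χ)`, `χ` running over the characters of `Γ`. -/
def IsGelfandTsetlin (M : Type*) [AddCommGroup M] [Module ℂ M] [Module U M]
    [IsScalarTower ℂ U M] : Prop :=
  Module.Finite U M ∧ iSupIndep (gtSpace M) ∧ ⨆ χ, gtSpace M χ = ⊤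

/-! ## Tableaux and the Gelfand-Tsetlin formulas -/

/-- A Gelfand-Tsetlin tableau of height `3` with complex entries, for `sl(3)`: since
`E_{11} + E_{22} + E_{33}` acts by zero, its top row satisfies `v_31 + v_32 + v_33 + 3 = 0`. -/
@[ext]
structure Tableau where
  v31 : ℂ
  v32 : ℂ
  v33 : ℂ
  v21 : ℂ
  v22 : ℂ
  v11 : ℂ
  top_sum : v31 + v32 + v33 + 3 = 0

namespace Tableau

/-- `v + x δ^{11}`. -/
def shift11 (v : Tableau) (x : ℂ) : Tableau := { v with v11 := v.v11 + x }

/-- `v` is generic: `v_21 - v_22` is not an integer. -/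
def IsGeneric (v : Tableau) : Prop := ∀ n : ℤ, v.v21 - v.v22 ≠ n

/-- `v` is a base point of a singular block: `v_21 = v_22`. -/
def IsCritical (v : Tableau) : Prop := v.v21 = v.v22

end Tableau

/-- The generators `E_12, E_21, E_23, E_32, H_1, H_2` of `sl(3)`. -/
inductive Gen
  | e12 | e21 | e23 | e32 | h1 | h2

namespace Gen

/-- The element of `U(sl(3))` given by a generator. -/
def toU : Gen → U
  | e12 => E 0 1
  | e21 => E 1 0
  | e23 => E 1 2
  | e32 => E 2 1
  | h1 => E 0 0 - E 1 1
  | h2 => E 1 1 - E 2 2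

/-- The Gelfand-Tsetlin formula of a generator: a pair `(N, ε)` in the list stands for the summand
`N(w_21, w_22, w_11) / (w_21 - w_22) • T(w + ε)` of the image of `T(w)`, where
`ε = (m, n, k)` means `m δ^{21} + n δ^{22} + k δ^{11}`. -/
def terms (v : Tableau) : Gen → List ((ℂ → ℂ → ℂ → ℂ) × (ℤ × ℤ × ℤ))
  | e12 => [(fun p q r => (p - q) * (-((p - r) * (q - r))), (0, 0, 1))]
  | e21 => [(fun p q _ => p - q, (0, 0, -1))]
  | e23 => [(fun p _ _ => (v.v31 - p) * (v.v32 - p) * (v.v33 - p), (1, 0, 0)),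
            (fun _ q _ => -((v.v31 - q) * (v.v32 - q) * (v.v33 - q)), (0, 1, 0))]
  | e32 => [(fun p _ r => p - r, (-1, 0, 0)), (fun _ q r => -(q - r), (0, -1, 0))]
  | h1 => [(fun p q r => (p - q) * (2 * r - (p + q + 1)), (0, 0, 0))]
  | h2 => [(fun p q r => (p - q) * (2 * (p + q + 1) - r), (0, 0, 0))]

end Gen

/-- The generic formulas: the image of `T(v + w)`, as a combination of the `T(v + w')`. -/
def actGeneric (v : Tableau) (g : Gen) (w : ℤ × ℤ × ℤ) : (ℤ × ℤ × ℤ) →₀ ℂ :=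
  ((g.terms v).map fun t => Finsupp.single (w + t.2)
    (t.1 (v.v21 + w.1) (v.v22 + w.2.1) (v.v11 + w.2.2) /
      ((v.v21 + w.1) - (v.v22 + w.2.1)))).sum

/-- For `v_21 = v_22` the basis vector of index `(m, n, k)` is `Tab(m, n, k)`, that is
`T(v + (m, n, k))` if `m ≤ n` and `DT(v + (m, n, k))` if `m > n`. This is the regular tableau
`T(v + z)` for arbitrary `z`, through the relation `T(v + z) = T(v + τ(z))`. -/
def regularTab (z : ℤ × ℤ × ℤ) : (ℤ × ℤ × ℤ) →₀ ℂ :=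
  if z.1 ≤ z.2.1 then Finsupp.single z 1 else Finsupp.single (z.2.1, z.1, z.2.2) 1

/-- The derivative tableau `DT(v + z)` for arbitrary `z`, through the relation
`DT(v + z) = -DT(v + τ(z))`. -/
def derivativeTab (z : ℤ × ℤ × ℤ) : (ℤ × ℤ × ℤ) →₀ ℂ :=
  if z.2.1 < z.1 then Finsupp.single z 1
  else if z.1 < z.2.1 then -Finsupp.single (z.2.1, z.1, z.2.2) 1
  else 0

/-- Let `f` be the coefficient `N / (v_21 - v_22)` at `v + w`. Restricted to the line
`(v_21 + t/2, v_22 - t/2)`, on which `v_21 - v_22` becomes `t` and along which `d/dt` at `t = 0`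
is `D = (∂_21 - ∂_22)/2`, this is `f` itself if `w_21 > w_22`, and `(v_21 - v_22) f`, with the
common factor `t` cancelled if `w_21 = w_22`, if `w_21 ≤ w_22`. -/
def criticalCoeff (v : Tableau) (N : ℂ → ℂ → ℂ → ℂ) (w : ℤ × ℤ × ℤ) (t : ℂ) : ℂ :=
  let p : ℂ := v.v21 + t / 2 + w.1
  let q : ℂ := v.v22 - t / 2 + w.2.1
  let r : ℂ := v.v11 + w.2.2
  if w.2.1 < w.1 then N p q r / (p - q)
  else if w.1 = w.2.1 then N p q r
  else t * (N p q r / (p - q))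

/-- The singular formulas: `E T(v + w) = D((v_21 - v_22) E T(v + w))` and
`E DT(v + w) = D(E T(v + w))`, where `D(f T(v + z)) = D(f) T(v + z) + f(v) DT(v + z)`. -/
def actCritical (v : Tableau) (g : Gen) (w : ℤ × ℤ × ℤ) : (ℤ × ℤ × ℤ) →₀ ℂ :=
  ((g.terms v).map fun t =>
    deriv (criticalCoeff v t.1 w) 0 • regularTab (w + t.2) +
      criticalCoeff v t.1 w 0 • derivativeTab (w + t.2)).sum

open Classical in
/-- The action of the generators of `sl(3)` on the basis `Tab(w)`, `w ∈ ℤ³`, of the universal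
tableaux module `V(T(v))`. -/
def act (v : Tableau) (g : Gen) (w : ℤ × ℤ × ℤ) : (ℤ × ℤ × ℤ) →₀ ℂ :=
  if v.IsCritical then actCritical v g w else actGeneric v g w

/-- The tableaux `Tab(w)`, `w ∈ S`, span a submodule of `V(T(v))`. -/
def SpansSubmodule (v : Tableau) (S : Set (ℤ × ℤ × ℤ)) : Prop :=
  ∀ g : Gen, ∀ w ∈ S, ∀ w' ∉ S, act v g w w' = 0

/-- `M` is a module `M(B; v)`, with tableaux basis `b`: it is a Gelfand-Tsetlin module, and it is
the subquotient of `V(T(v))` with basis `Tab(w)`, `w ∈ B`. That is, `B` is the difference of the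
index sets of two submodules of `V(T(v))`, and the generators act on `b` by the Gelfand-Tsetlin
formulas with all tableaux outside `B` omitted. -/
structure IsTableauxBasis {M : Type*} [AddCommGroup M] [Module ℂ M] [Module U M]
    [IsScalarTower ℂ U M] (B : Set (ℤ × ℤ × ℤ)) (v : Tableau) (b : Module.Basis B ℂ M) :
    Prop where
  gelfandTsetlin : IsGelfandTsetlin M
  subquotient : ∃ S₁ S₂, SpansSubmodule v S₁ ∧ SpansSubmodule v S₂ ∧ B = S₁ \ S₂
  action : ∀ (g : Gen) (w w' : B), b.repr (g.toU • b w) w' = act v g w w'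

section Uniqueness

attribute [local instance] LieRing.ofAssociativeRing

theorem E_mul_sub (i j k l : Fin 3) (hij : i ≠ j) (hkl : k ≠ l) (hil : i ≠ l) (hjk : j = k) :
    E i j * E k l - E k l * E i j = E i l := by
  subst hjk
  rw [← adE_apply, E, E, adE_ι, E]
  congr 1
  apply Subtype.ext
  rw [LieAlgebra.SpecialLinear.sl_bracket]
  simp [slE, hij, hkl, hil, hil.symm]

theorem adjoin_toU : Algebra.adjoin ℂ (Set.range Gen.toU) = ⊤ := by
  set S := Algebra.adjoin ℂ (Set.range Gen.toU) with hS
  have hg : ∀ g : Gen, g.toU ∈ S := fun g => Algebra.subset_adjoin ⟨g, rfl⟩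
  have h01 : E 0 1 ∈ S := hg .e12
  have h10 : E 1 0 ∈ S := hg .e21
  have h12 : E 1 2 ∈ S := hg .e23
  have h21 : E 2 1 ∈ S := hg .e32
  have h02 : E 0 2 ∈ S := by
    rw [← E_mul_sub 0 1 1 2 (by decide) (by decide) (by decide) rfl]
    exact S.sub_mem (S.mul_mem h01 h12) (S.mul_mem h12 h01)
  have h20 : E 2 0 ∈ S := by
    rw [← E_mul_sub 2 1 1 0 (by decide) (by decide) (by decide) rfl]
    exact S.sub_mem (S.mul_mem h21 h10) (S.mul_mem h10 h21)
  have hsum : E 0 0 + E 1 1 + E 2 2 = 0 := by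
    have : slE 0 0 + slE 1 1 + slE 2 2 = 0 := by
      apply Subtype.ext
      ext i j
      fin_cases i <;> fin_cases j <;> simp [slE] <;> norm_num
    rw [E, E, E, ← map_add, ← map_add, this, map_zero]
  have h1 : E 0 0 - E 1 1 ∈ S := hg .h1
  have h2 : E 1 1 - E 2 2 ∈ S := hg .h2
  have h00 : E 0 0 ∈ S := by
    have : E 0 0 = (1 / 3 : ℂ) • ((2 : ℂ) • (E 0 0 - E 1 1) + (E 1 1 - E 2 2)) := by
      rw [← eq_neg_iff_add_eq_zero] at hsum
      have h3 : E 2 2 = -(E 0 0 + E 1 1) := by rw [hsum, neg_neg]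
      rw [h3]; module
    rw [this]
    exact S.smul_mem (S.add_mem (S.smul_mem h1 _) h2) _
  have h11 : E 1 1 ∈ S := by simpa using S.sub_mem h00 h1
  have h22 : E 2 2 ∈ S := by simpa using S.sub_mem h11 h2
  have hE : ∀ i j, E i j ∈ S := by
    intro i j
    fin_cases i <;> fin_cases j <;> assumption
  have hι : ∀ x : sl3, UniversalEnvelopingAlgebra.ι ℂ x ∈ S := by
    intro x
    have hx : x = ∑ i, ∑ j, (x.val i j) • slE i j := by
      have ht : x.val 0 0 + x.val 1 1 + x.val 2 2 = 0 := by
        have := x.2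
        change Matrix.trace x.val = 0 at this
        rwa [Matrix.trace_fin_three] at this
      apply Subtype.ext
      ext i j
      fin_cases i <;> fin_cases j <;> simp [slE, Fin.sum_univ_three] <;>
        linear_combination (1 / 3 : ℂ) * ht
    rw [hx]
    simp only [map_sum, map_smul]
    exact S.sum_mem fun i _ => S.sum_mem fun j _ => S.smul_mem (hE i j) _
  let j : sl3 →ₗ⁅ℂ⁆ S :=
    { toFun := fun x => ⟨UniversalEnvelopingAlgebra.ι ℂ x, hι x⟩
      map_add' := fun x y => Subtype.ext (map_add _ x y)
      map_smul' := fun c x => Subtype.ext (map_smul _ c x)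
      map_lie' := fun {x y} => Subtype.ext (LieHom.map_lie _ x y) }
  have h : S.val.comp (UniversalEnvelopingAlgebra.lift ℂ j) = AlgHom.id ℂ U := by
    apply UniversalEnvelopingAlgebra.hom_ext
    ext x
    change ((UniversalEnvelopingAlgebra.lift ℂ j) (UniversalEnvelopingAlgebra.ι ℂ x) : U) = _
    rw [UniversalEnvelopingAlgebra.lift_ι_apply]
    rfl
  rw [eq_top_iff]
  intro u _
  have h2 : ((UniversalEnvelopingAlgebra.lift ℂ j) u : U) = u := DFunLike.congr_fun h u
  rw [← h2]
  exact ((UniversalEnvelopingAlgebra.lift ℂ j) u).2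

/-- The module `M(B; v)` is determined by `B` and `v` up to isomorphism. -/
theorem IsTableauxBasis.unique {M M' : Type*} [AddCommGroup M] [Module ℂ M] [Module U M]
    [IsScalarTower ℂ U M] [AddCommGroup M'] [Module ℂ M'] [Module U M'] [IsScalarTower ℂ U M']
    {B : Set (ℤ × ℤ × ℤ)} {v : Tableau} {b : Module.Basis B ℂ M} {b' : Module.Basis B ℂ M'}
    (h : IsTableauxBasis B v b) (h' : IsTableauxBasis B v b') :
    ∃ φ : M ≃ₗ[U] M', ∀ w, φ (b w) = b' w := by
  let e : M ≃ₗ[ℂ] M' := b.equiv b' (Equiv.refl _)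
  have he : ∀ w, e (b w) = b' w := fun w => by simp [e]
  have h1 : ∀ u : U, ∀ y : M, e (u • y) = u • e y := by
    intro u
    have hu : u ∈ Algebra.adjoin ℂ (Set.range Gen.toU) := by rw [adjoin_toU]; trivial
    induction hu using Algebra.adjoin_induction with
    | mem u hu =>
      obtain ⟨g, rfl⟩ := hu
      intro y
      suffices H : e.toLinearMap ∘ₗ Algebra.lsmul ℂ ℂ M g.toU =
          Algebra.lsmul ℂ ℂ M' g.toU ∘ₗ e.toLinearMap from DFunLike.congr_fun H y
      refine b.ext fun w => ?_
      change e (g.toU • b w) = g.toU • e (b w)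
      rw [he]
      apply b'.repr.injective
      ext w'
      rw [h'.action, ← h.action]
      simp [e, Module.Basis.equiv]
    | algebraMap c => intro y; simp [algebraMap_smul]
    | add a c _ _ ha hc => intro y; rw [add_smul, map_add, ha, hc, add_smul]
    | mul a c _ _ ha hc => intro y; rw [mul_smul, ha, hc, mul_smul]
  exact ⟨{ e with map_smul' := h1 }, he⟩

end Uniqueness

/-- `B + ℕ δ^{11}`. -/
def addN (B : Set (ℤ × ℤ × ℤ)) : Set (ℤ × ℤ × ℤ) :=
  {w | ∃ t : ℕ, (w.1, w.2.1, w.2.2 - (t : ℤ)) ∈ B}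

theorem mem_addN {B : Set (ℤ × ℤ × ℤ)} {w : ℤ × ℤ × ℤ} (h : w ∈ B) : w ∈ addN B :=
  ⟨0, by simpa using h⟩

/-! ## Localization and twisted localization with respect to `E_21` -/

instance : OreLocalization.OreSet (Submonoid.powers E21) :=
  Classical.choice (nonempty_oreSet E21 adE_E21_nilp)

/-- `D_12 U`, the localization of `U` at the powers of `E_21`. -/
abbrev DU := OreLocalization (Submonoid.powers E21) U

/-- `E_21` as a unit of `D_12 U`. -/
def unitE21 : DUˣ := OreLocalization.numeratorUnit (⟨E21, Submonoid.mem_powers _⟩ :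
  Submonoid.powers E21)

theorem adE_unitE21_nilp (a : DU) : ∃ n, (adE (unitE21 : DU) ^ n) a = 0 := by
  let ν : U →+* DU := OreLocalization.numeratorRingHom
  have hν : ∀ (n : ℕ) (u : U), (adE (unitE21 : DU) ^ n) (ν u) = ν ((adE E21 ^ n) u) := by
    intro n u
    induction n with
    | zero => simp
    | succ n ih =>
      rw [pow_succ', pow_succ', Module.End.mul_apply, Module.End.mul_apply, ih, adE_apply,
        adE_apply, map_sub, map_mul, map_mul]
      rfl
  induction a using OreLocalization.ind with
  | _ r s =>
    obtain ⟨n, hn⟩ := adE_E21_nilp r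
    have h1 : ∃ m : ℕ, (adE (unitE21 : DU) ^ m) ((1 : U) /ₒ s) = 0 := by
      refine ⟨1, ?_⟩
      obtain ⟨_, k, rfl⟩ := s
      let φ : DUˣ := OreLocalization.numeratorUnit (⟨E21 ^ k, k, rfl⟩ : Submonoid.powers E21)
      have hφ : Commute (unitE21 : DU) (φ : DU) := by
        change ν E21 * ν (E21 ^ k) = ν (E21 ^ k) * ν E21
        rw [← map_mul, ← map_mul, ← pow_succ, ← pow_succ']
      rw [pow_one, adE_apply, sub_eq_zero]
      exact hφ.units_inv_right.eq
    have h2 : r /ₒ s = ((1 : U) /ₒ s) * ν r := by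
      change _ = _ * (r /ₒ 1)
      rw [OreLocalization.mul_div_one, one_mul]
    rw [h2]
    exact (adNilp (unitE21 : DU)).mul_mem h1 ⟨n, by rw [hν, hn, map_zero]⟩

/-- The automorphism `Θ_x` of `D_12 U`. -/
def Θ (x : ℂ) : DU →ₐ[ℂ] DU := theta unitE21 adE_unitE21_nilp x

/-- The twist `Φ^x M` of a `D_12 U`-module `M`: the same space, on which `u ∈ D_12 U` acts as
`Θ_x(u)` does on `M`. -/
def Twist (_x : ℂ) (M : Type*) : Type _ := M

section Twist

variable (x : ℂ) (M : Type*) [AddCommGroup M]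

instance : AddCommGroup (Twist x M) := inferInstanceAs (AddCommGroup M)

instance [Module ℂ M] : Module ℂ (Twist x M) := inferInstanceAs (Module ℂ M)

instance [Module DU M] : Module DU (Twist x M) := Module.compHom M (Θ x).toRingHom

instance [Module DU M] : Module U (Twist x M) :=
  Module.compHom (Twist x M)
    (OreLocalization.numeratorRingHom : U →+* DU)

instance [Module ℂ M] [Module DU M] [IsScalarTower ℂ DU M] : IsScalarTower ℂ DU (Twist x M) where
  smul_assoc c a y := by
    change (Θ x (c • a)) • (show M from y) = c • ((Θ x a) • (show M from y))
    rw [map_smul, smul_assoc]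

instance [Module ℂ M] [Module DU M] [IsScalarTower ℂ DU M] : IsScalarTower ℂ U (Twist x M) where
  smul_assoc c u y := by
    let ν : U →+* DU := OreLocalization.numeratorRingHom
    have h : ν (c • u) = c • ν u := by
      rw [← smul_one_mul c u, map_mul, ← smul_eq_mul, ← OreLocalization.smul_one_oreDiv_one_smul]
      rfl
    change ν (c • u) • y = c • (ν u • y)
    rw [h, smul_assoc]

/-- The element `y^x` of `Φ^x M` corresponding to `y ∈ M`. -/
def toTwist [Module ℂ M] : M ≃ₗ[ℂ] Twist x M := LinearEquiv.refl ℂ M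

theorem smul_toTwist [Module ℂ M] [Module DU M] (a : DU) (y : M) :
    a • toTwist x M y = toTwist x M (Θ x a • y) := rfl

end Twist

section Localization

variable (L : Type*) [AddCommGroup L] [Module U L]

/-- `D_12 L`, the localization of `L` at the powers of `E_21`. -/
abbrev D12 := OreLocalization (Submonoid.powers E21) L

/-- The canonical map `L → D_12 L`. -/
def toD12 : L →ₗ[U] D12 L where
  toFun l := l /ₒ 1
  map_add' _ _ := OreLocalization.add_oreDiv.symm
  map_smul' u l := (OreLocalization.smul_oreDiv_one u l).symm

/-- The twisted localization `D_12^x L = Φ^x (D_12 L)`. -/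
abbrev D12x (x : ℂ) := Twist x (D12 L)

/-- `QD_12 L = D_12 L / L`. -/
abbrev QD12 := D12 L ⧸ LinearMap.range (toD12 L)

end Localization

end GTsl3

end

open GTsl3

/-! The generator `f = E_21` acts on tableaux by the pure translation `Tab(w) ↦ Tab(w - δ^{11})`,
with coefficient `1`, in the generic and in the singular case (`act_e21`). Injectivity of `f`
therefore means that `B` is closed under `-δ^{11}`, and `f^{-t} Tab(w)` behaves like `Tab(w + t
δ^{11})`. So `D_12 L` has a basis indexed by `B + ℕ δ^{11}` (`exists_basis_D12`).

What remains is to compute the twisted action in this basis, and this is done by interpolation. A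
matrix coefficient of `Θ_x(u)` is polynomial in `x`, since `ad f` is locally nilpotent. The
Gelfand-Tsetlin coefficient at `v + x δ^{11}` is polynomial in `x` too, since `v_11` enters no
denominator. For `x = -n` with `n` large, conjugation by `f^n` carries the first into the action on
`L`, and translation by `-n δ^{11}` does the same to the second. Two polynomials that agree at
infinitely many points are equal (`repr_Θ_smul`). The same principle shows that `S + ℕ δ^{11}` spans
a submodule of `V(T(v + x δ^{11}))` when `S` spans one of `V(T(v))` (`SpansSubmodule.addN`).

The result must also be a Gelfand-Tsetlin module. `Θ_x` fixes `c_{mk}` for `m ≥ 2` and sends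
`c_{11}` to `c_{11} + x`, so it preserves `Γ`, and powers of `f` carry weight spaces into weight
spaces (`toTwist_fPow_mem_iSup_gtSpace`). Finite generation (`finite_twist`) comes from a single
vector: `E_12` and `E_21` produce from it a whole line in direction `δ^{11}`, local nilpotency makes
the generated submodule stable under `f^{-1}`, and simplicity of `L` makes it everything. Quotients
are read off by deleting basis vectors (`IsTableauxBasis.quotient`). -/

namespace GTsl3

/-! ### The Gelfand-Tsetlin formulas along the direction `δ^{11}`. -/

section Action

/-- `w + k δ^{11}`. -/
def moveK (w : ℤ × ℤ × ℤ) (k : ℤ) : ℤ × ℤ × ℤ := (w.1, w.2.1, w.2.2 + k)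

@[simp] theorem moveK_fst (w : ℤ × ℤ × ℤ) (k : ℤ) : (moveK w k).1 = w.1 := rfl

@[simp] theorem moveK_snd_fst (w : ℤ × ℤ × ℤ) (k : ℤ) : (moveK w k).2.1 = w.2.1 := rfl

@[simp] theorem moveK_snd_snd (w : ℤ × ℤ × ℤ) (k : ℤ) : (moveK w k).2.2 = w.2.2 + k := rfl

@[simp] theorem moveK_zero (w : ℤ × ℤ × ℤ) : moveK w 0 = w := by simp [moveK]

@[simp] theorem moveK_moveK (w : ℤ × ℤ × ℤ) (k l : ℤ) : moveK (moveK w k) l = moveK w (k + l) := by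
  simp [moveK, add_assoc]

theorem moveK_injective (k : ℤ) : Function.Injective (moveK · k) := by
  intro w w' h
  simpa using congrArg (moveK · (-k)) h

theorem moveK_add (w e : ℤ × ℤ × ℤ) (k : ℤ) : moveK (w + e) k = moveK w k + e := by
  ext <;> simp; ring

theorem mem_addN_iff {B : Set (ℤ × ℤ × ℤ)} {w : ℤ × ℤ × ℤ} :
    w ∈ addN B ↔ ∃ t : ℕ, moveK w (-(t : ℤ)) ∈ B := Iff.rfl

/-- The contribution of a summand `(N, ε)` of the Gelfand-Tsetlin formulas. -/
noncomputable def termAct (v : Tableau) (t : (ℂ → ℂ → ℂ → ℂ) × (ℤ × ℤ × ℤ)) (w : ℤ × ℤ × ℤ) :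
    (ℤ × ℤ × ℤ) →₀ ℂ :=
  open Classical in
  if v.IsCritical then deriv (criticalCoeff v t.1 w) 0 • regularTab (w + t.2) +
    criticalCoeff v t.1 w 0 • derivativeTab (w + t.2)
  else Finsupp.single (w + t.2)
    (t.1 (v.v21 + w.1) (v.v22 + w.2.1) (v.v11 + w.2.2) / ((v.v21 + w.1) - (v.v22 + w.2.1)))

theorem act_eq (v : Tableau) (g : Gen) (w : ℤ × ℤ × ℤ) :
    act v g w = ((g.terms v).map fun t => termAct v t w).sum := by
  by_cases h : v.IsCritical
  · simp only [act, termAct, if_pos h]; rfl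
  · simp only [act, termAct, if_neg h]; rfl

theorem act_apply (v : Tableau) (g : Gen) (w w' : ℤ × ℤ × ℤ) :
    act v g w w' = ((g.terms v).map fun t => termAct v t w w').sum := by
  rw [act_eq]
  induction g.terms v with
  | nil => simp
  | cons a l ih => simp [ih]

/-! ### Translations along `δ^{11}` -/

theorem regularTab_moveK (z w' : ℤ × ℤ × ℤ) (k : ℤ) :
    regularTab (moveK z k) (moveK w' k) = regularTab z w' := by
  have h : ∀ a, moveK a k = moveK w' k ↔ a = w' := fun a => (moveK_injective k).eq_iff
  change (if z.1 ≤ z.2.1 then Finsupp.single (moveK z k) (1 : ℂ)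
    else Finsupp.single (moveK (z.2.1, z.1, z.2.2) k) 1) (moveK w' k) = _
  unfold regularTab
  split_ifs <;> simp only [Finsupp.single_apply, h]

theorem derivativeTab_moveK (z w' : ℤ × ℤ × ℤ) (k : ℤ) :
    derivativeTab (moveK z k) (moveK w' k) = derivativeTab z w' := by
  have h : ∀ a, moveK a k = moveK w' k ↔ a = w' := fun a => (moveK_injective k).eq_iff
  change (if z.2.1 < z.1 then Finsupp.single (moveK z k) (1 : ℂ)
    else if z.1 < z.2.1 then -Finsupp.single (moveK (z.2.1, z.1, z.2.2) k) 1 else 0)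
    (moveK w' k) = _
  unfold derivativeTab
  split_ifs <;> simp [Finsupp.single_apply, h]

theorem criticalCoeff_moveK (v : Tableau) (N : ℂ → ℂ → ℂ → ℂ) (w : ℤ × ℤ × ℤ) (k : ℤ) :
    criticalCoeff v N (moveK w k) = criticalCoeff (v.shift11 k) N w := by
  funext t
  have : v.v11 + ((w.2.2 + k : ℤ) : ℂ) = v.v11 + k + w.2.2 := by push_cast; ring
  simp only [criticalCoeff, moveK, Tableau.shift11, this]

theorem termAct_moveK (v : Tableau) (t : (ℂ → ℂ → ℂ → ℂ) × (ℤ × ℤ × ℤ)) (w w' : ℤ × ℤ × ℤ)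
    (k : ℤ) : termAct v t (moveK w k) (moveK w' k) = termAct (v.shift11 k) t w w' := by
  by_cases h : v.IsCritical
  · have h' : (v.shift11 k).IsCritical := h
    simp only [termAct, if_pos h, if_pos h', ← moveK_add, criticalCoeff_moveK, Finsupp.add_apply,
      Finsupp.smul_apply, regularTab_moveK, derivativeTab_moveK]
  · have h' : ¬ (v.shift11 k).IsCritical := h
    have h2 : v.v11 + ((w.2.2 + k : ℤ) : ℂ) = v.v11 + k + w.2.2 := by push_cast; ring
    simp only [termAct, if_neg h, if_neg h', ← moveK_add, Finsupp.single_apply,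
      (moveK_injective k).eq_iff]
    simp only [moveK, Tableau.shift11, h2]

/-- The third coordinate enters the coefficients only through its sum with `v_11`, and the choice
between regular and derivative tableaux ignores it. -/
theorem act_moveK (v : Tableau) (g : Gen) (w w' : ℤ × ℤ × ℤ) (k : ℤ) :
    act v g (moveK w k) (moveK w' k) = act (v.shift11 k) g w w' := by
  simp only [act_apply, termAct_moveK]; rfl

theorem shift11_zero (v : Tableau) : v.shift11 0 = v := by simp [Tableau.shift11]

/-! ### Polynomial dependence on `v_11` -/

/-- `f` is a polynomial function. -/
def IsPolyFun (f : ℂ → ℂ) : Prop := ∃ p : Polynomial ℂ, ∀ x, f x = p.eval x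

theorem IsPolyFun.const (c : ℂ) : IsPolyFun fun _ => c := ⟨Polynomial.C c, by simp⟩

theorem IsPolyFun.add {f g : ℂ → ℂ} (hf : IsPolyFun f) (hg : IsPolyFun g) :
    IsPolyFun fun x => f x + g x := by
  obtain ⟨p, hp⟩ := hf
  obtain ⟨q, hq⟩ := hg
  exact ⟨p + q, by simp [hp, hq]⟩

theorem IsPolyFun.mul {f g : ℂ → ℂ} (hf : IsPolyFun f) (hg : IsPolyFun g) :
    IsPolyFun fun x => f x * g x := by
  obtain ⟨p, hp⟩ := hf
  obtain ⟨q, hq⟩ := hg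
  exact ⟨p * q, by simp [hp, hq]⟩

theorem IsPolyFun.sum {ι : Type*} (s : Finset ι) {f : ι → ℂ → ℂ} (hf : ∀ i ∈ s, IsPolyFun (f i)) :
    IsPolyFun fun x => ∑ i ∈ s, f i x := by
  induction s using Finset.cons_induction with
  | empty => simpa using IsPolyFun.const 0
  | cons a s ha ih =>
    simp only [Finset.sum_cons]
    exact (hf a (by simp)).add (ih fun i hi => hf i (by simp [hi]))

/-- The test points are negative because index sets are closed under `-δ^{11}`: far enough down,
everything lies in `B`. -/
theorem IsPolyFun.eq_of_frequently {f g : ℂ → ℂ} (hf : IsPolyFun f) (hg : IsPolyFun g) (n₀ : ℕ)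
    (h : ∀ n : ℕ, n₀ ≤ n → f (-(n : ℂ)) = g (-(n : ℂ))) : f = g := by
  obtain ⟨p, hp⟩ := hf
  obtain ⟨q, hq⟩ := hg
  suffices p = q by funext x; rw [hp, hq, this]
  apply Polynomial.eq_of_infinite_eval_eq
  have hinj : Function.Injective fun n : ℕ => -((n + n₀ : ℕ) : ℂ) := by
    intro a b hab
    have : a + n₀ = b + n₀ := by exact_mod_cast neg_injective hab
    omega
  apply (Set.infinite_range_of_injective hinj).mono
  rintro _ ⟨n, rfl⟩
  change Polynomial.eval _ p = Polynomial.eval _ q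
  rw [← hp, ← hq, h _ (by omega)]

theorem IsPolyFun.eventually_ne {f : ℂ → ℂ} (hf : IsPolyFun f) {x : ℂ} (hx : f x ≠ 0) :
    ∃ n₀ : ℕ, ∀ n : ℕ, n₀ ≤ n → f (-(n : ℂ)) ≠ 0 := by
  obtain ⟨p, hp⟩ := hf
  have h0 : p ≠ 0 := by rintro rfl; simp [hp] at hx
  have hfin : {n : ℕ | p.IsRoot (-(n : ℂ))}.Finite := by
    apply (p.finite_setOfPred_isRoot h0).preimage
    intro a _ b _ hab
    exact_mod_cast neg_injective hab
  obtain ⟨n₀, hn₀⟩ := hfin.bddAbove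
  refine ⟨n₀ + 1, fun n hn h => ?_⟩
  have := hn₀ (show p.IsRoot (-(n : ℂ)) by rw [Polynomial.IsRoot, ← hp, h])
  omega

/-- `N(p, q, r)` is a polynomial of degree at most `2` in `r`, with differentiable coefficients. -/
structure IsQuadratic (N : ℂ → ℂ → ℂ → ℂ) : Prop where
  exists_coeff : ∃ a : Fin 3 → ℂ → ℂ → ℂ,
    (∀ i α β, Differentiable ℂ fun t : ℂ => a i (α + t / 2) (β - t / 2)) ∧
    ∀ p q r, N p q r = ∑ i : Fin 3, a i p q * r ^ (i : ℕ)

/-- Separating the powers of `r` isolates the dependence on `v_11`. Differentiability is required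
along `(α + t/2, β - t/2)`, the line on which the singular formulas take their derivative. -/
theorem isQuadratic_terms (v : Tableau) (g : Gen) : ∀ t ∈ g.terms v, IsQuadratic t.1 := by
  have key : ∀ (a b c : ℂ → ℂ → ℂ) (N : ℂ → ℂ → ℂ → ℂ),
      (∀ α β, Differentiable ℂ fun t : ℂ => a (α + t / 2) (β - t / 2)) →
      (∀ α β, Differentiable ℂ fun t : ℂ => b (α + t / 2) (β - t / 2)) →
      (∀ α β, Differentiable ℂ fun t : ℂ => c (α + t / 2) (β - t / 2)) →
      (∀ p q r, N p q r = a p q + b p q * r + c p q * r ^ 2) → IsQuadratic N := by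
    intro a b c N ha hb hc hN
    refine ⟨![a, b, c], fun i => ?_, fun p q r => ?_⟩
    · fin_cases i
      exacts [ha, hb, hc]
    · simp [Fin.sum_univ_three, hN]
  cases g <;> simp only [Gen.terms, List.forall_mem_cons, List.not_mem_nil, false_imp_iff,
    implies_true, and_true]
  · exact key (fun p q => -((p - q) * p * q)) (fun p q => (p - q) * (p + q)) (fun p q => -(p - q))
      _ (by intros; fun_prop) (by intros; fun_prop) (by intros; fun_prop) (by intros; ring)
  · exact key (fun p q => p - q) (fun _ _ => 0) (fun _ _ => 0)
      _ (by intros; fun_prop) (by intros; fun_prop) (by intros; fun_prop) (by intros; ring)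
  · constructor
    · exact key (fun p _ => (v.v31 - p) * (v.v32 - p) * (v.v33 - p)) (fun _ _ => 0) (fun _ _ => 0)
        _ (by intros; fun_prop) (by intros; fun_prop) (by intros; fun_prop) (by intros; ring)
    · exact key (fun _ q => -((v.v31 - q) * (v.v32 - q) * (v.v33 - q))) (fun _ _ => 0)
        (fun _ _ => 0)
        _ (by intros; fun_prop) (by intros; fun_prop) (by intros; fun_prop) (by intros; ring)
  · constructor
    · exact key (fun p _ => p) (fun _ _ => -1) (fun _ _ => 0)
        _ (by intros; fun_prop) (by intros; fun_prop) (by intros; fun_prop) (by intros; ring)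
    · exact key (fun _ q => -q) (fun _ _ => 1) (fun _ _ => 0)
        _ (by intros; fun_prop) (by intros; fun_prop) (by intros; fun_prop) (by intros; ring)
  · exact key (fun p q => -((p - q) * (p + q + 1))) (fun p q => 2 * (p - q)) (fun _ _ => 0)
      _ (by intros; fun_prop) (by intros; fun_prop) (by intros; fun_prop) (by intros; ring)
  · exact key (fun p q => (p - q) * (2 * (p + q + 1))) (fun p q => -(p - q)) (fun _ _ => 0)
      _ (by intros; fun_prop) (by intros; fun_prop) (by intros; fun_prop) (by intros; ring)

theorem criticalCoeff_sub (v : Tableau) (hv : v.IsCritical) (w : ℤ × ℤ × ℤ) (t : ℂ) :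
    (v.v21 + t / 2 + w.1) - (v.v22 - t / 2 + w.2.1) = t + ((w.1 - w.2.1 : ℤ) : ℂ) := by
  rw [show v.v21 = v.v22 from hv]; push_cast; ring

theorem eventually_criticalCoeff_sub_ne (v : Tableau) (hv : v.IsCritical) (w : ℤ × ℤ × ℤ)
    (hw : w.1 ≠ w.2.1) :
    ∀ᶠ t : ℂ in nhds 0, (v.v21 + t / 2 + w.1) - (v.v22 - t / 2 + w.2.1) ≠ 0 := by
  simp only [criticalCoeff_sub v hv w]
  have h : ContinuousAt (fun t : ℂ => t + ((w.1 - w.2.1 : ℤ) : ℂ)) 0 := by fun_prop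
  apply h.eventually_ne
  simpa [sub_eq_zero] using hw

/-- On the line the denominator is `t + (w_21 - w_22)`. It vanishes at `t = 0` only for `w_21 =
w_22`, the case where it has been cancelled. -/
theorem differentiableAt_criticalCoeff (v : Tableau) (hv : v.IsCritical) (a : ℂ → ℂ → ℂ)
    (ha : ∀ α β, Differentiable ℂ fun t : ℂ => a (α + t / 2) (β - t / 2)) (w : ℤ × ℤ × ℤ) :
    DifferentiableAt ℂ (criticalCoeff v (fun p q _ => a p q) w) 0 := by
  have ha' : Differentiable ℂ fun t : ℂ => a (v.v21 + t / 2 + w.1) (v.v22 - t / 2 + w.2.1) := by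
    have := ha (v.v21 + w.1) (v.v22 + w.2.1)
    convert this using 3 <;> ring
  unfold criticalCoeff
  simp only [criticalCoeff_sub v hv w]
  split_ifs with h1 h2
  · refine (ha' 0).div (by fun_prop) ?_
    simpa [sub_eq_zero] using (by omega : w.1 ≠ w.2.1)
  · exact ha' 0
  · refine DifferentiableAt.mul (by fun_prop) ((ha' 0).div (by fun_prop) ?_)
    simpa [sub_eq_zero] using h2

theorem criticalCoeff_shift11_sum (v : Tableau) (a : Fin 3 → ℂ → ℂ → ℂ) (w : ℤ × ℤ × ℤ) (x t : ℂ) :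
    criticalCoeff (v.shift11 x) (fun p q r => ∑ i : Fin 3, a i p q * r ^ (i : ℕ)) w t =
      ∑ i : Fin 3, criticalCoeff v (fun p q _ => a i p q) w t * (v.v11 + x + w.2.2) ^ (i : ℕ) := by
  unfold criticalCoeff
  simp only [Tableau.shift11, Fin.sum_univ_three]
  split_ifs <;> ring

theorem isPolyFun_criticalCoeff (v : Tableau) {N : ℂ → ℂ → ℂ → ℂ} (hN : IsQuadratic N)
    (w : ℤ × ℤ × ℤ) (t : ℂ) : IsPolyFun fun x => criticalCoeff (v.shift11 x) N w t := by
  obtain ⟨a, -, h⟩ := hN.exists_coeff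
  obtain rfl : N = fun p q r => ∑ i : Fin 3, a i p q * r ^ (i : ℕ) := by
    funext p q r; exact h p q r
  simp only [criticalCoeff_shift11_sum]
  refine IsPolyFun.sum _ fun i _ => (IsPolyFun.const _).mul
    ⟨(Polynomial.C v.v11 + Polynomial.X + Polynomial.C (w.2.2 : ℂ)) ^ (i : ℕ), by simp⟩

theorem isPolyFun_deriv_criticalCoeff (v : Tableau) (hv : v.IsCritical) {N : ℂ → ℂ → ℂ → ℂ}
    (hN : IsQuadratic N) (w : ℤ × ℤ × ℤ) :
    IsPolyFun fun x => deriv (criticalCoeff (v.shift11 x) N w) 0 := by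
  obtain ⟨a, ha, h⟩ := hN.exists_coeff
  obtain rfl : N = fun p q r => ∑ i : Fin 3, a i p q * r ^ (i : ℕ) := by
    funext p q r; exact h p q r
  -- The derivative is taken in the direction `δ^{21} - δ^{22}`, so the powers of `v_11 + x + w_11`
  -- are constants for it.
  have h2 : ∀ x, deriv (criticalCoeff (v.shift11 x)
      (fun p q r => ∑ i : Fin 3, a i p q * r ^ (i : ℕ)) w) 0 =
      ∑ i : Fin 3, deriv (criticalCoeff v (fun p q _ => a i p q) w) 0 *
        (v.v11 + x + w.2.2) ^ (i : ℕ) := by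
    intro x
    rw [funext (criticalCoeff_shift11_sum v a w x)]
    apply HasDerivAt.deriv
    exact HasDerivAt.fun_sum fun i _ =>
      (differentiableAt_criticalCoeff v hv (a i) (ha i) w).hasDerivAt.mul_const _
  simp only [h2]
  refine IsPolyFun.sum _ fun i _ => (IsPolyFun.const _).mul
    ⟨(Polynomial.C v.v11 + Polynomial.X + Polynomial.C (w.2.2 : ℂ)) ^ (i : ℕ), by simp⟩

theorem isPolyFun_termAct (v : Tableau) (t : (ℂ → ℂ → ℂ → ℂ) × (ℤ × ℤ × ℤ))
    (ht : IsQuadratic t.1) (w w' : ℤ × ℤ × ℤ) :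
    IsPolyFun fun x => termAct (v.shift11 x) t w w' := by
  by_cases h : v.IsCritical
  · have h' : ∀ x, (v.shift11 x).IsCritical := fun x => h
    simp only [termAct, if_pos (h' _), Finsupp.add_apply, Finsupp.smul_apply, smul_eq_mul]
    exact ((isPolyFun_deriv_criticalCoeff v h ht w).mul (IsPolyFun.const _)).add
      ((isPolyFun_criticalCoeff v ht w 0).mul (IsPolyFun.const _))
  · have h' : ∀ x, ¬ (v.shift11 x).IsCritical := fun x => h
    simp only [termAct, if_neg (h' _), Finsupp.single_apply]
    split_ifs
    · obtain ⟨a, -, ha⟩ := ht.exists_coeff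
      simp only [ha, Tableau.shift11, div_eq_mul_inv]
      refine IsPolyFun.mul (IsPolyFun.sum _ fun i _ => (IsPolyFun.const _).mul ?_)
        (IsPolyFun.const _)
      exact ⟨(Polynomial.C v.v11 + Polynomial.X + Polynomial.C (w.2.2 : ℂ)) ^ (i : ℕ), by simp⟩
    · exact IsPolyFun.const 0

theorem isPolyFun_act (v : Tableau) (g : Gen) (w w' : ℤ × ℤ × ℤ) :
    IsPolyFun fun x => act (v.shift11 x) g w w' := by
  simp only [act_apply]
  change IsPolyFun fun x => ((g.terms v).map fun t => termAct (v.shift11 x) t w w').sum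
  have h := isQuadratic_terms v g
  generalize g.terms v = l at h
  induction l with
  | nil => exact IsPolyFun.const 0
  | cons a l ih =>
    simp only [List.map_cons, List.sum_cons]
    exact (isPolyFun_termAct v a (h a (by simp)) w w').add (ih fun t ht => h t (by simp [ht]))

/-! ### The action of `E_21` and `E_12` -/

/-- The factor `p - q` cancels the denominator wherever the latter is nonzero. Equality near `0`
suffices for both the value and the derivative there. -/
theorem criticalCoeff_mul_of_lt (v : Tableau) (hv : v.IsCritical) (h : ℂ → ℂ → ℂ → ℂ)
    (w : ℤ × ℤ × ℤ) (hw : w.2.1 < w.1) :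
    criticalCoeff v (fun p q r => (p - q) * h p q r) w =ᶠ[nhds 0]
      fun t => h (v.v21 + t / 2 + w.1) (v.v22 - t / 2 + w.2.1) (v.v11 + w.2.2) := by
  filter_upwards [eventually_criticalCoeff_sub_ne v hv w (by omega)] with t ht
  simp only [criticalCoeff, if_pos hw]
  rw [mul_div_cancel_left₀ _ ht]

theorem criticalCoeff_mul_of_le (v : Tableau) (hv : v.IsCritical) (h : ℂ → ℂ → ℂ → ℂ)
    (w : ℤ × ℤ × ℤ) (hw : w.1 ≤ w.2.1) :
    criticalCoeff v (fun p q r => (p - q) * h p q r) w =ᶠ[nhds 0]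
      fun t => t * h (v.v21 + t / 2 + w.1) (v.v22 - t / 2 + w.2.1) (v.v11 + w.2.2) := by
  rcases hw.eq_or_lt with hw | hw
  · filter_upwards with t
    have h0 := criticalCoeff_sub v hv w t
    rw [hw, sub_self, Int.cast_zero, add_zero, ← hw] at h0
    simp only [criticalCoeff, if_neg (show ¬ w.2.1 < w.1 by omega), if_pos hw]
    rw [← hw, h0]
  · filter_upwards [eventually_criticalCoeff_sub_ne v hv w (by omega)] with t ht
    simp only [criticalCoeff, if_neg (show ¬ w.2.1 < w.1 by omega),
      if_neg (show ¬ w.1 = w.2.1 by omega)]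
    rw [mul_div_cancel_left₀ _ ht]

/-- Here the coefficient is `t * h`, so it vanishes at `0` with derivative `h(0)`: regular tableaux
go to regular tableaux. -/
theorem deriv_criticalCoeff_mul_of_le (v : Tableau) (hv : v.IsCritical) (h : ℂ → ℂ → ℂ → ℂ)
    (w : ℤ × ℤ × ℤ) (hw : w.1 ≤ w.2.1)
    (hd : Differentiable ℂ fun t : ℂ =>
      h (v.v21 + t / 2 + w.1) (v.v22 - t / 2 + w.2.1) (v.v11 + w.2.2)) :
    deriv (criticalCoeff v (fun p q r => (p - q) * h p q r) w) 0 =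
      h (v.v21 + w.1) (v.v22 + w.2.1) (v.v11 + w.2.2) := by
  rw [(criticalCoeff_mul_of_le v hv h w hw).deriv_eq]
  refine (HasDerivAt.mul (hasDerivAt_id' (0 : ℂ)) (hd 0).hasDerivAt).deriv.trans ?_
  simp

theorem act_of_terms_eq_singleton (v : Tableau) (g : Gen) (w : ℤ × ℤ × ℤ)
    {t : (ℂ → ℂ → ℂ → ℂ) × (ℤ × ℤ × ℤ)} (ht : g.terms v = [t]) : act v g w = termAct v t w := by
  simp [act_eq, ht]

theorem sub_ne_zero_of_isGeneric {v : Tableau} (hv : v.IsGeneric) (w : ℤ × ℤ × ℤ) :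
    (v.v21 + w.1) - (v.v22 + w.2.1) ≠ 0 := by
  intro h
  apply hv (w.2.1 - w.1)
  push_cast
  linear_combination h

theorem not_isCritical_of_isGeneric {v : Tableau} (hv : v.IsGeneric) : ¬ v.IsCritical := by
  intro h
  apply hv 0
  rw [Int.cast_zero, sub_eq_zero]
  exact h

/-- A summand `((p - q) h(p, q, r), k δ^{11})` acts on regular tableaux, and on all tableaux
if `v` is generic, by the scalar `h` and a translation. -/
theorem termAct_mul_of_regular (v : Tableau) (h : ℂ → ℂ → ℂ → ℂ) (w : ℤ × ℤ × ℤ) (k : ℤ)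
    (hv : v.IsGeneric ∨ v.IsCritical ∧ w.1 ≤ w.2.1)
    (hd : Differentiable ℂ fun t : ℂ =>
      h (v.v21 + t / 2 + w.1) (v.v22 - t / 2 + w.2.1) (v.v11 + w.2.2)) :
    termAct v (fun p q r => (p - q) * h p q r, (0, 0, k)) w = Finsupp.single (moveK w k)
      (h (v.v21 + w.1) (v.v22 + w.2.1) (v.v11 + w.2.2)) := by
  have hm : w + (0, 0, k) = moveK w k := by ext <;> simp
  rcases hv with hv | ⟨hv, hw⟩
  · simp only [termAct, if_neg (not_isCritical_of_isGeneric hv), hm]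
    rw [mul_div_cancel_left₀ _ (sub_ne_zero_of_isGeneric hv w)]
  · simp only [termAct, if_pos hv, hm, deriv_criticalCoeff_mul_of_le v hv h w hw hd,
      (criticalCoeff_mul_of_le v hv h w hw).eq_of_nhds]
    simp [regularTab, hw]

/-- A summand `((p - q) h(p, q, r), k δ^{11})` acts on derivative tableaux by the scalar `h` and
a translation, up to regular tableaux. -/
theorem termAct_mul_of_derivative (v : Tableau) (h : ℂ → ℂ → ℂ → ℂ) (w : ℤ × ℤ × ℤ) (k : ℤ)
    (hv : v.IsCritical) (hw : w.2.1 < w.1) :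
    termAct v (fun p q r => (p - q) * h p q r, (0, 0, k)) w =
      Finsupp.single (w.2.1, w.1, w.2.2 + k) (deriv (fun t : ℂ =>
        h (v.v21 + t / 2 + w.1) (v.v22 - t / 2 + w.2.1) (v.v11 + w.2.2)) 0) +
      Finsupp.single (moveK w k) (h (v.v21 + w.1) (v.v22 + w.2.1) (v.v11 + w.2.2)) := by
  have hm : w + (0, 0, k) = moveK w k := by ext <;> simp
  simp only [termAct, if_pos hv, hm, (criticalCoeff_mul_of_lt v hv h w hw).deriv_eq,
    (criticalCoeff_mul_of_lt v hv h w hw).eq_of_nhds]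
  simp [regularTab, derivativeTab, hw, hw.not_ge]

/-- This is the case `h = 1`: the regular correction on a derivative tableau is the derivative of a
constant, hence zero. -/
theorem act_e21 (v : Tableau) (hv : v.IsGeneric ∨ v.IsCritical) (w : ℤ × ℤ × ℤ) :
    act v .e21 w = Finsupp.single (moveK w (-1)) 1 := by
  have ht : Gen.terms v .e21 = [(fun p q r => (p - q) * (fun _ _ _ => 1) p q r, (0, 0, -1))] := by
    simp [Gen.terms]
  rw [act_of_terms_eq_singleton v _ w ht]
  by_cases h : v.IsCritical ∧ w.2.1 < w.1
  · rw [termAct_mul_of_derivative v (fun _ _ _ => 1) w _ h.1 h.2]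
    simp
  · refine termAct_mul_of_regular v (fun _ _ _ => 1) w _ ?_ (by fun_prop)
    rcases hv with hv | hv
    · exact .inl hv
    · exact .inr ⟨hv, not_lt.1 fun hw => h ⟨hv, hw⟩⟩

theorem terms_e12 (v : Tableau) : Gen.terms v .e12 =
    [(fun p q r => (p - q) * (fun p q r => -((p - r) * (q - r))) p q r, (0, 0, 1))] := rfl

theorem act_e12_self (v : Tableau) (hv : v.IsGeneric ∨ v.IsCritical) (w : ℤ × ℤ × ℤ) :
    act v .e12 w (moveK w 1) = -((v.v21 + w.1 - (v.v11 + w.2.2)) *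
      (v.v22 + w.2.1 - (v.v11 + w.2.2))) := by
  rw [act_of_terms_eq_singleton v _ w (terms_e12 v)]
  by_cases h : v.IsCritical ∧ w.2.1 < w.1
  · rw [termAct_mul_of_derivative v _ w _ h.1 h.2]
    rw [Finsupp.add_apply, Finsupp.single_eq_same, Finsupp.single_eq_of_ne, zero_add]
    -- The correction sits on the mirror index, which differs from `moveK w 1` because `w.1 ≠
    -- w.2.1`.
    intro h2
    have := congrArg Prod.fst h2
    simp at this
    omega
  · rw [termAct_mul_of_regular v _ w _ _ (by fun_prop), Finsupp.single_eq_same]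
    rcases hv with hv | hv
    · exact .inl hv
    · exact .inr ⟨hv, not_lt.1 fun hw => h ⟨hv, hw⟩⟩

theorem act_e12_eq_zero (v : Tableau) (hv : v.IsGeneric ∨ v.IsCritical) (w w' : ℤ × ℤ × ℤ)
    (h1 : w' ≠ moveK w 1) (h2 : w.2.1 < w.1 → w' ≠ (w.2.1, w.1, w.2.2 + 1)) :
    act v .e12 w w' = 0 := by
  rw [act_of_terms_eq_singleton v _ w (terms_e12 v)]
  by_cases h : v.IsCritical ∧ w.2.1 < w.1
  · rw [termAct_mul_of_derivative v _ w _ h.1 h.2]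
    rw [Finsupp.add_apply, Finsupp.single_eq_of_ne h1, Finsupp.single_eq_of_ne (h2 h.2), zero_add]
  · rw [termAct_mul_of_regular v _ w _ _ (by fun_prop), Finsupp.single_eq_of_ne h1]
    rcases hv with hv | hv
    · exact .inl hv
    · exact .inr ⟨hv, not_lt.1 fun hw => h ⟨hv, hw⟩⟩

end Action

/-! ### The family `Θ_x`: group law and values on special elements. -/

section Theta

theorem IsPolyFun.comp_add_const {f : ℂ → ℂ} (hf : IsPolyFun f) (c : ℂ) :
    IsPolyFun fun x => f (x + c) := by
  obtain ⟨p, hp⟩ := hf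
  exact ⟨p.comp (Polynomial.X + Polynomial.C c), by simp [hp]⟩

theorem IsPolyFun.sub {f g : ℂ → ℂ} (hf : IsPolyFun f) (hg : IsPolyFun g) :
    IsPolyFun fun x => f x - g x := by
  obtain ⟨p, hp⟩ := hf
  obtain ⟨q, hq⟩ := hg
  exact ⟨p - q, by simp [hp, hq]⟩

theorem IsPolyFun.comp_neg {f : ℂ → ℂ} (hf : IsPolyFun f) : IsPolyFun fun x => f (-x) := by
  obtain ⟨p, hp⟩ := hf
  exact ⟨p.comp (-Polynomial.X), by simp [hp]⟩

theorem isPolyFun_choose (i : ℕ) : IsPolyFun fun x => Ring.choose x i :=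
  ⟨binomPoly i, fun x => (binomPoly_eval i x).symm⟩

variable {R : Type*} [Ring R] [Algebra ℂ R] (f : Rˣ)

theorem isPolyFun_thetaFun (hf : ∀ u : R, ∃ n, (adE (f : R) ^ n) u = 0) (φ : R →ₗ[ℂ] ℂ) (u : R) :
    IsPolyFun fun x => φ (thetaFun f x u) := by
  obtain ⟨n, hn⟩ := hf u
  simp only [thetaFun_eq_sum f _ hn, map_sum, map_smul, smul_eq_mul]
  exact IsPolyFun.sum _ fun i _ => (isPolyFun_choose i).mul (IsPolyFun.const _)

/-- For natural `x`, `Θ_x` is conjugation by `f^x`, where the identity is clear. Both sides are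
polynomial in `x` after applying any functional. -/
theorem thetaFun_add_one (hf : ∀ u : R, ∃ n, (adE (f : R) ^ n) u = 0) (x : ℂ) (u : R) :
    thetaFun f (x + 1) u = f * thetaFun f x u * ((f⁻¹ : Rˣ) : R) := by
  obtain ⟨n, hn⟩ := hf u
  rw [← sub_eq_zero]
  refine eq_zero_of_natCast
    (fun x => thetaFun f (x + 1) u - f * thetaFun f x u * ((f⁻¹ : Rˣ) : R)) ?_ ?_ x
  · intro φ
    simp only [map_sub]
    exact ((isPolyFun_thetaFun f hf φ u).comp_add_const 1).sub
      (isPolyFun_thetaFun f hf (φ ∘ₗ LinearMap.mulRight ℂ ((f⁻¹ : Rˣ) : R) ∘ₗ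
        LinearMap.mulLeft ℂ (f : R)) u)
  · intro m
    have h := thetaFun_natCast f (m + 1) hn
    push_cast at h
    rw [h, thetaFun_natCast f m hn, sub_eq_zero, pow_succ' (f : R), pow_succ]
    simp only [mul_assoc]

theorem thetaFun_add_intCast (hf : ∀ u : R, ∃ n, (adE (f : R) ^ n) u = 0) (x : ℂ) (n : ℤ) (u : R) :
    thetaFun f (x + n) u = ((f ^ n : Rˣ) : R) * thetaFun f x u * ((f ^ (-n) : Rˣ) : R) := by
  induction n with
  | zero => simp
  | succ n ih =>
    have h : x + ((n + 1 : ℤ) : ℂ) = x + ((n : ℤ) : ℂ) + 1 := by push_cast; ring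
    rw [h, thetaFun_add_one f hf, ih, neg_add, zpow_add f (-(n : ℤ)), add_comm (n : ℤ) 1, zpow_add]
    simp only [zpow_one, Units.val_mul, zpow_neg_one, mul_assoc]
  | pred n ih =>
    have h := thetaFun_add_one f hf (x + ((-(n : ℤ) - 1 : ℤ) : ℂ)) u
    have h2 : x + ((-(n : ℤ) - 1 : ℤ) : ℂ) + 1 = x + ((-(n : ℤ) : ℤ) : ℂ) := by push_cast; ring
    rw [h2, ih] at h
    have h3 : thetaFun f (x + ((-(n : ℤ) - 1 : ℤ) : ℂ)) u = ((f⁻¹ : Rˣ) : R) *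
        (f * thetaFun f (x + ((-(n : ℤ) - 1 : ℤ) : ℂ)) u * ((f⁻¹ : Rˣ) : R)) * f := by
      simp [mul_assoc]
    rw [h3, ← h, neg_sub, sub_neg_eq_add, sub_eq_neg_add, zpow_add, neg_neg, add_comm (1 : ℤ),
      zpow_add]
    simp only [zpow_one, Units.val_mul, zpow_neg_one, mul_assoc]

theorem thetaFun_zero (hf : ∀ u : R, ∃ n, (adE (f : R) ^ n) u = 0) (u : R) :
    thetaFun f 0 u = u := by
  obtain ⟨n, hn⟩ := hf u
  simpa using thetaFun_natCast f 0 hn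

theorem thetaFun_intCast (hf : ∀ u : R, ∃ n, (adE (f : R) ^ n) u = 0) (n : ℤ) (u : R) :
    thetaFun f n u = ((f ^ n : Rˣ) : R) * u * ((f ^ (-n) : Rˣ) : R) := by
  simpa [thetaFun_zero f hf] using thetaFun_add_intCast f hf 0 n u

theorem thetaFun_thetaFun_neg (hf : ∀ u : R, ∃ n, (adE (f : R) ^ n) u = 0) (x : ℂ) (u : R) :
    thetaFun f x (thetaFun f (-x) u) = u := by
  obtain ⟨n, hn⟩ := hf u
  rw [← sub_eq_zero]
  refine eq_zero_of_natCast (fun x => thetaFun f x (thetaFun f (-x) u) - u) ?_ ?_ x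
  · intro φ
    have hN : (thetaN f ^ n) u = 0 := by rw [thetaN_pow, hn, zero_mul]
    -- The number of terms depends on `u` only, so the composite stays polynomial when `y = -x`.
    have h1 : ∀ x y, thetaFun f x (thetaFun f y u) = ∑ i ∈ Finset.range n,
        Ring.choose y i • thetaFun f x ((thetaN f ^ i) u) := by
      intro x y
      rw [thetaFun_eq_sum f y hn]
      change theta f hf x _ = ∑ i ∈ Finset.range n, _ • theta f hf x _
      simp only [map_sum, map_smul]
    simp only [h1, map_sub, map_sum, map_smul, smul_eq_mul]
    exact (IsPolyFun.sum _ fun i _ => (isPolyFun_choose i).comp_neg.mul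
      (isPolyFun_thetaFun f hf φ _)).sub (IsPolyFun.const _)
  · intro m
    have h1 := thetaFun_intCast f hf m
    have h2 := thetaFun_intCast f hf (-m)
    push_cast at h1 h2
    have h3 : ((f ^ (m : ℤ) : Rˣ) : R) * ((f ^ (-(m : ℤ)) : Rˣ) : R) = 1 := by
      rw [← Units.val_mul, ← zpow_add]; simp
    rw [h1, h2, sub_eq_zero, neg_neg]
    calc _ = ((f ^ (m : ℤ) : Rˣ) : R) * ((f ^ (-(m : ℤ)) : Rˣ) : R) * u *
          (((f ^ (m : ℤ) : Rˣ) : R) * ((f ^ (-(m : ℤ)) : Rˣ) : R)) := by simp only [mul_assoc]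
      _ = u := by rw [h3]; simp

theorem thetaFun_of_commute (x : ℂ) {u : R} (h : (f : R) * u = u * f) : thetaFun f x u = u := by
  rw [thetaFun_eq_sum f x (n := 1) (by simp [adE_apply, h])]; simp

/-- Only the terms `i = 0, 1` of the series survive. This applies to `u = E_11`, as `[E_21, E_11] =
E_21`. -/
theorem thetaFun_of_sub_eq (x : ℂ) {u : R} (h : (f : R) * u - u * f = f) :
    thetaFun f x u = u + algebraMap ℂ R x := by
  rw [thetaFun_eq_sum f x (n := 2) (by
    rw [pow_two, Module.End.mul_apply, adE_apply _ u, h, adE_apply, sub_self])]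
  have : thetaN f u = 1 := by
    rw [thetaN_apply]
    have h2 : (f : R) * u = f + u * f := sub_eq_iff_eq_add.1 h
    rw [h2, add_mul, mul_assoc]; simp
  simp [Finset.sum_range_succ, this, Algebra.algebraMap_eq_smul_one]

end Theta

/-! ### Commutativity of the Gelfand-Tsetlin subalgebra. -/

section GelfandTsetlinSubalgebra

attribute [local instance] LieRing.ofAssociativeRing

theorem slE_lie (a b c d : Fin 3) : ⁅slE a b, slE c d⁆ =
    (if b = c then slE a d else 0) - (if d = a then slE c b else 0) := by
  apply Subtype.ext
  rw [LieAlgebra.SpecialLinear.sl_bracket]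
  -- The scalar matrices subtracted by the projection onto `sl(3)` drop out of commutators.
  have h : ∀ (s t : ℂ) (x y : Matrix (Fin 3) (Fin 3) ℂ),
      (x - s • 1) * (y - t • 1) - (y - t • 1) * (x - s • 1) = x * y - y * x := by
    intro s t x y
    simp only [mul_sub, sub_mul, mul_smul_comm, smul_mul_assoc, mul_one, one_mul]
    module
  have h2 : ∀ i j k l : Fin 3, Matrix.single i j (1 : ℂ) * Matrix.single k l 1 =
      if j = k then Matrix.single i l 1 else 0 := by
    intro i j k l
    split_ifs with hjk
    · subst hjk; simp
    · simp [hjk]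
  simp only [slE, h, h2]
  by_cases h1 : b = c <;> by_cases h3 : d = a
  · subst h1 h3; simp
  · have h3' : ¬ a = d := fun h => h3 h.symm
    simp [h1, h3, h3']
  · have h1' : ¬ c = b := fun h => h1 h.symm
    simp [h1, h3, h1']
  · simp [h1, h3]

theorem E_mul_sub_E_mul (a b c d : Fin 3) : E a b * E c d - E c d * E a b =
    (if b = c then E a d else 0) - (if d = a then E c b else 0) := by
  rw [← adE_apply, E, E, adE_ι, slE_lie, map_sub, apply_ite (UniversalEnvelopingAlgebra.ι ℂ),
    apply_ite (UniversalEnvelopingAlgebra.ι ℂ), map_zero]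
  rfl

/-- The matrix of the generators `E_{ij}`, `i, j ≤ m`, of `gl(m)`. -/
noncomputable def genMatrix (m : ℕ) : Matrix (Fin 3) (Fin 3) U :=
  Matrix.of fun i j => if (i : ℕ) < m ∧ (j : ℕ) < m then E i j else 0

theorem genMatrix_apply (m : ℕ) (i j : Fin 3) :
    genMatrix m i j = if (i : ℕ) < m ∧ (j : ℕ) < m then E i j else 0 := rfl

/-- The entries of every power transform under `ad E_{ab}` as matrix units do, because `ad` is a
derivation. The trace is then invariant. -/
theorem adE_genMatrix_pow (m : ℕ) (a b : Fin 3) (ha : (a : ℕ) < m) (hb : (b : ℕ) < m) (k : ℕ) :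
    ∀ i j, adE (E a b) ((genMatrix m ^ (k + 1)) i j) =
      (if b = i then (genMatrix m ^ (k + 1)) a j else 0) -
        (if j = a then (genMatrix m ^ (k + 1)) i b else 0) := by
  have h1 : ∀ i j, adE (E a b) (genMatrix m i j) =
      (if b = i then genMatrix m a j else 0) - (if j = a then genMatrix m i b else 0) := by
    intro i j
    simp only [genMatrix_apply, ha, hb, true_and, and_true]
    by_cases hi : (i : ℕ) < m <;> by_cases hj : (j : ℕ) < m
    · simp [hi, hj, adE_apply, E_mul_sub_E_mul]
    · have : j ≠ a := by rintro rfl; exact hj ha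
      simp [hj, this]
    · have : b ≠ i := by rintro rfl; exact hi hb
      simp [hi, this]
    · have : j ≠ a := by rintro rfl; exact hj ha
      simp [hi, hj, this]
  induction k with
  | zero => simpa using h1
  | succ k ih =>
    intro i j
    rw [pow_succ' (genMatrix m) (k + 1)]
    simp only [Matrix.mul_apply, map_sum, adE_mul, h1, ih, sub_mul, mul_sub, ite_mul, mul_ite,
      zero_mul, mul_zero, Finset.sum_add_distrib, Finset.sum_sub_distrib]
    -- The two halves of the Leibniz rule contribute the cross term `G i b * G^(k+1) a j` with
    -- opposite signs.
    split_ifs <;> simp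
    abel

theorem adE_trace_genMatrix_pow (m : ℕ) (a b : Fin 3) (ha : (a : ℕ) < m) (hb : (b : ℕ) < m)
    (k : ℕ) : adE (E a b) (genMatrix m ^ (k + 1)).trace = 0 := by
  simp [Matrix.trace, adE_genMatrix_pow m a b ha hb]

/-- The index `j + 1` in `Fin (k + 1)` is cyclic, so both sides sum over closed paths with vertices
at most `m`. Only `k ≤ 2` occurs in `Γ`, and these three cases are expanded. -/
theorem gtGen_eq_trace (m k : ℕ) (hk : k < 3) : gtGen m k = (genMatrix m ^ (k + 1)).trace := by
  have hcons : ∀ (n : ℕ) (F : (Fin (n + 1) → Fin 3) → U),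
      ∑ i, F i = ∑ a, ∑ i : Fin n → Fin 3, F (Fin.cons a i) := by
    intro n F
    rw [← (Fin.consEquiv fun _ => Fin 3).sum_comp, Fintype.sum_prod_type]
    rfl
  rw [gtGen, Finset.sum_filter]
  interval_cases k
  · simp only [hcons, Finset.univ_unique, Finset.sum_singleton, Matrix.trace, zero_add, pow_one,
      Matrix.diag_apply, genMatrix_apply]
    refine Finset.sum_congr rfl fun i _ => ?_
    by_cases hi : (i : ℕ) < m <;> simp [hi]
  · simp only [hcons, Finset.univ_unique, Finset.sum_singleton, Matrix.trace, pow_succ, pow_zero,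
      one_mul, Matrix.diag_apply, Matrix.mul_apply, genMatrix_apply]
    refine Finset.sum_congr rfl fun i _ => Finset.sum_congr rfl fun j _ => ?_
    by_cases hi : (i : ℕ) < m <;> by_cases hj : (j : ℕ) < m <;> simp [hi, hj, Fin.forall_fin_succ]
  · simp only [hcons, Finset.univ_unique, Finset.sum_singleton, Matrix.trace, pow_succ, pow_zero,
      one_mul, Matrix.diag_apply, Matrix.mul_apply, genMatrix_apply, Finset.sum_mul]
    refine Finset.sum_congr rfl fun i _ => ?_
    rw [Finset.sum_comm]
    refine Finset.sum_congr rfl fun j _ => Finset.sum_congr rfl fun l _ => ?_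
    by_cases hi : (i : ℕ) < m <;> by_cases hj : (j : ℕ) < m <;> by_cases hl : (l : ℕ) < m <;>
      simp [hi, hj, hl, Fin.forall_fin_succ, mul_assoc]
    rfl

theorem commute_E_gtGen (m k : ℕ) (hk : k < 3) (a b : Fin 3) (ha : (a : ℕ) < m)
    (hb : (b : ℕ) < m) : Commute (E a b) (gtGen m k) := by
  have h := adE_trace_genMatrix_pow m a b ha hb k
  rw [adE_apply, sub_eq_zero, ← gtGen_eq_trace m k hk] at h
  exact h

/-- The smaller element is a polynomial in the `E_{ij}` with `i, j ≤ m ≤ m'`, and each of these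
commutes with the larger one. -/
theorem commute_gtGen (m k m' k' : ℕ) (hk' : k' < 3) (hm : m ≤ m') :
    Commute (gtGen m k) (gtGen m' k') := by
  rw [gtGen]
  refine Commute.sum_left _ _ _ fun i hi => ?_
  simp only [Finset.mem_filter, Finset.mem_univ, true_and] at hi
  refine Commute.list_prod_left _ _ fun u hu => ?_
  rw [List.mem_ofFn] at hu
  obtain ⟨j, rfl⟩ := hu
  exact commute_E_gtGen m' k' hk' _ _ ((hi _).trans_le hm) ((hi _).trans_le hm)

theorem commute_of_mem_gtSubalgebra {a c : U} (ha : a ∈ gtSubalgebra) (hc : c ∈ gtSubalgebra) :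
    Commute a c := by
  have : IsMulCommutative gtSubalgebra := Algebra.isMulCommutative_adjoin ℂ
    (s := {c : U | ∃ m k : ℕ, k < m ∧ m ≤ 3 ∧ c = gtGen m k}) (by
      rintro _ ⟨m, k, hk, hm, rfl⟩ _ ⟨m', k', hk', hm', rfl⟩
      rcases le_total m m' with h | h
      · exact commute_gtGen m k m' k' (by omega) h
      · exact (commute_gtGen m' k' m k (by omega) h).symm)
  exact setLike_mul_comm ha hc

theorem gtGen_zero_eq : gtGen 1 0 = E 0 0 := by
  rw [gtGen_eq_trace 1 0 (by norm_num)]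
  simp [Matrix.trace, genMatrix_apply]

end GelfandTsetlinSubalgebra

/-! ### Weight spaces, transport of tableaux bases, and quotients. -/

section Modules

variable {M : Type*} [AddCommGroup M] [Module ℂ M] [Module U M] [IsScalarTower ℂ U M]

/-- Joint generalized eigenspaces of commuting operators are independent, so this part of
`IsGelfandTsetlin` holds for every module. -/
theorem iSupIndep_gtSpace : iSupIndep (gtSpace M) := by
  have h := Module.End.independent_iInf_maxGenEigenspace_of_forall_mapsTo
    (fun γ : gtSubalgebra => (Algebra.lsmul ℂ ℂ M (γ : U) : Module.End ℂ M)) fun γ δ c =>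
      Module.End.mapsTo_maxGenEigenspace_of_comm
        ((commute_of_mem_gtSubalgebra δ.2 γ.2).map (Algebra.lsmul ℂ ℂ M)) c
  exact h.comp (f := fun χ : gtSubalgebra →ₐ[ℂ] ℂ => (χ : gtSubalgebra → ℂ))
    DFunLike.coe_injective

theorem mem_gtSpace {χ : gtSubalgebra →ₐ[ℂ] ℂ} {m : M} : m ∈ gtSpace M χ ↔
    ∀ γ : gtSubalgebra, ∃ k : ℕ, ((Algebra.lsmul ℂ ℂ M (γ : U) - χ γ • 1) ^ k) m = 0 := by
  simp [gtSpace, Module.End.mem_maxGenEigenspace]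

variable {M' : Type*} [AddCommGroup M'] [Module ℂ M'] [Module U M'] [IsScalarTower ℂ U M']

/-- The map need not be `U`-linear: it may intertwine `γ` with another element `δ`. This covers the
maps `l ↦ (f^n l)^x`, which shift the weights. -/
theorem map_mem_gtSpace (ψ : M →ₗ[ℂ] M') {χ χ' : gtSubalgebra →ₐ[ℂ] ℂ}
    (h : ∀ γ : gtSubalgebra, ∃ δ : gtSubalgebra, χ δ = χ' γ ∧
      ∀ m, (γ : U) • ψ m = ψ ((δ : U) • m)) {m : M} (hm : m ∈ gtSpace M χ) :
    ψ m ∈ gtSpace M' χ' := by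
  rw [mem_gtSpace] at hm ⊢
  intro γ
  obtain ⟨δ, hδ, h⟩ := h γ
  obtain ⟨k, hk⟩ := hm δ
  refine ⟨k, ?_⟩
  have h2 : (Algebra.lsmul ℂ ℂ M' (γ : U) - χ' γ • 1) ∘ₗ ψ =
      ψ ∘ₗ (Algebra.lsmul ℂ ℂ M (δ : U) - χ δ • 1) := by
    ext y
    simp [h, hδ]
  have h3 := Module.End.commute_pow_left_of_commute h2 k
  have h4 := DFunLike.congr_fun h3 m
  simp only [LinearMap.comp_apply, hk, map_zero] at h4
  exact h4

theorem IsGelfandTsetlin.of_surjective (h : IsGelfandTsetlin M) (φ : M →ₗ[U] M')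
    (hφ : Function.Surjective φ) : IsGelfandTsetlin M' := by
  obtain ⟨h1, -, h2⟩ := h
  refine ⟨Module.Finite.of_surjective φ hφ, iSupIndep_gtSpace, ?_⟩
  rw [eq_top_iff, ← LinearMap.range_eq_top.2 (show Function.Surjective (φ.restrictScalars ℂ) from hφ),
    ← Submodule.map_top, ← h2, Submodule.map_iSup]
  refine iSup_mono fun χ => ?_
  rintro _ ⟨m, hm, rfl⟩
  exact map_mem_gtSpace (φ.restrictScalars ℂ) (fun γ => ⟨γ, rfl, fun m => (map_smul φ _ m).symm⟩) hm

theorem IsTableauxBasis.map {B : Set (ℤ × ℤ × ℤ)} {v : Tableau} {b : Module.Basis B ℂ M}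
    (h : IsTableauxBasis B v b) (e : M ≃ₗ[U] M') :
    IsTableauxBasis B v (b.map (e.restrictScalars ℂ)) where
  gelfandTsetlin := h.gelfandTsetlin.of_surjective e.toLinearMap e.surjective
  subquotient := h.subquotient
  action g w w' := by
    rw [← h.action g w w']
    change b.repr (e.symm (g.toU • e (b w))) w' = _
    rw [map_smul, LinearEquiv.symm_apply_apply]

/-- The basis of a quotient by the span of a part of a basis. -/
theorem exists_basis_quotient {ι : Type*} {A B : Set ι} (b : Module.Basis A ℂ M)
    (K : Submodule U M)
    (hK : K.restrictScalars ℂ = Submodule.span ℂ (b '' {w | (w : ι) ∈ B})) :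
    ∃ bQ : Module.Basis (A \ B : Set ι) ℂ (M ⧸ K),
      (∀ w : (A \ B : Set ι), bQ w = K.mkQ (b ⟨w, w.2.1⟩)) ∧
      ∀ m (w : (A \ B : Set ι)), bQ.repr (K.mkQ m) w = b.repr m ⟨w, w.2.1⟩ := by
  classical
  -- Since `K` is a coordinate subspace, membership is a condition on supports.
  have hmem : ∀ m, m ∈ K ↔ ((b.repr m).support : Set A) ⊆ {w | (w : ι) ∈ B} := fun m => by
    rw [← Submodule.restrictScalars_mem ℂ, hK, Module.Basis.mem_span_image]
  let j : (A \ B : Set ι) → A := fun w => ⟨w, w.2.1⟩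
  have hj : Function.Injective j := fun x y h => Subtype.ext (congrArg (fun z : A => (z : ι)) h)
  have hli : LinearIndependent ℂ fun w => K.mkQ (b (j w)) := by
    rw [linearIndependent_iff']
    intro s g hg i hi
    have h1 : ∑ i ∈ s, g i • b (j i) ∈ K := by
      rw [← Submodule.Quotient.mk_eq_zero, ← hg, ← Submodule.mkQ_apply, map_sum]
      rfl
    rw [hmem] at h1
    by_contra hgi
    refine i.2.2 (h1 (a := j i) ?_)
    simp only [Finset.mem_coe, Finsupp.mem_support_iff, map_sum, map_smul, Module.Basis.repr_self,
      Finsupp.finsetSum_apply, Finsupp.smul_apply, smul_eq_mul, Finsupp.single_apply, hj.eq_iff]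
    simpa [hi] using hgi
  have hsp : ⊤ ≤ Submodule.span ℂ (Set.range fun w => K.mkQ (b (j w))) := by
    rw [← LinearMap.range_eq_top.2
      (show Function.Surjective (K.mkQ.restrictScalars ℂ) from K.mkQ_surjective),
      ← Submodule.map_top, ← b.span_eq, Submodule.map_span, Submodule.span_le]
    rintro _ ⟨_, ⟨w, rfl⟩, rfl⟩
    by_cases hw : (w : ι) ∈ B
    · have : K.mkQ (b w) = 0 := by
        rw [Submodule.mkQ_apply, Submodule.Quotient.mk_eq_zero, hmem]
        intro i hi
        simp only [Module.Basis.repr_self, Finset.mem_coe, Finsupp.mem_support_iff,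
          Finsupp.single_apply] at hi
        obtain rfl : w = i := by by_contra h; simp [h] at hi
        exact hw
      change K.mkQ (b w) ∈ _
      rw [this]
      exact zero_mem _
    · exact Submodule.subset_span ⟨⟨w, w.2, hw⟩, rfl⟩
  refine ⟨Module.Basis.mk hli hsp, fun w => by simp [j], fun m w => ?_⟩
  have h : Finsupp.lapply w ∘ₗ (Module.Basis.mk hli hsp).repr.toLinearMap ∘ₗ
      K.mkQ.restrictScalars ℂ = Finsupp.lapply (j w) ∘ₗ b.repr.toLinearMap := by
    refine b.ext fun a => ?_
    change (Module.Basis.mk hli hsp).repr (K.mkQ (b a)) w = b.repr (b a) (j w)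
    by_cases ha : (a : ι) ∈ B
    · have h1 : K.mkQ (b a) = 0 := by
        rw [Submodule.mkQ_apply, Submodule.Quotient.mk_eq_zero, hmem]
        intro i hi
        simp only [Module.Basis.repr_self, Finset.mem_coe, Finsupp.mem_support_iff,
          Finsupp.single_apply] at hi
        obtain rfl : a = i := by by_contra h; simp [h] at hi
        exact ha
      have h2 : j w ≠ a := by rintro rfl; exact w.2.2 ha
      rw [h1, map_zero, Module.Basis.repr_self, Finsupp.single_eq_of_ne h2]
      rfl
    · obtain ⟨w', rfl⟩ : ∃ w', j w' = a := ⟨⟨a, a.2, ha⟩, rfl⟩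
      have h1 : K.mkQ (b (j w')) = Module.Basis.mk hli hsp w' := by simp
      rw [h1, Module.Basis.repr_self, Module.Basis.repr_self, Finsupp.single_apply,
        Finsupp.single_apply]
      simp only [hj.eq_iff]
  exact DFunLike.congr_fun h m

theorem IsTableauxBasis.quotient {A B : Set (ℤ × ℤ × ℤ)} (hBA : B ⊆ A) {v : Tableau}
    {b : Module.Basis A ℂ M} (h : IsTableauxBasis A v b) (K : Submodule U M)
    (hK : K.restrictScalars ℂ = Submodule.span ℂ (b '' {w | (w : ℤ × ℤ × ℤ) ∈ B})) :
    ∃ bQ : Module.Basis (A \ B : Set (ℤ × ℤ × ℤ)) ℂ (M ⧸ K), IsTableauxBasis (A \ B) v bQ ∧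
      ∀ w : (A \ B : Set (ℤ × ℤ × ℤ)), bQ w = K.mkQ (b ⟨w, w.2.1⟩) := by
  obtain ⟨bQ, h1, h2⟩ := exists_basis_quotient b K hK
  refine ⟨bQ, ⟨h.gelfandTsetlin.of_surjective K.mkQ K.mkQ_surjective, ?_, fun g w w' => ?_⟩, h1⟩
  · obtain ⟨S₁, S₂, hS₁, hS₂, rfl⟩ := h.subquotient
    -- From `B` nothing leaves `S₁`. Coefficients into `S₁ \ S₂` are those of the action on `M`, and
    -- they vanish outside `B` because `K` is a submodule.
    refine ⟨S₁, S₂ ∪ B, hS₁, ?_, by rw [Set.sdiff_sdiff]⟩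
    rintro g w (hw | hw) w' hw'
    · exact hS₂ g w hw w' fun h => hw' (.inl h)
    · by_cases hw₁ : w' ∈ S₁
      · have hd : w' ∈ S₁ \ S₂ := ⟨hw₁, fun h => hw' (.inl h)⟩
        rw [← h.action g ⟨w, hBA hw⟩ ⟨w', hd⟩]
        have hm : g.toU • b ⟨w, hBA hw⟩ ∈ K.restrictScalars ℂ := by
          refine K.smul_mem _ ?_
          rw [← Submodule.restrictScalars_mem ℂ, hK]
          exact Submodule.subset_span ⟨_, hw, rfl⟩
        rw [hK, Module.Basis.mem_span_image] at hm
        by_contra hne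
        exact hw' (.inr (hm (Finsupp.mem_support_iff.2 hne)))
      · exact hS₁ g w (hBA hw).1 w' hw₁
  · rw [h1, ← map_smul, h2, h.action]

end Modules

/-! ### Sets spanning submodules -/

theorem SpansSubmodule.moveK_mem {v : Tableau} (hv : v.IsGeneric ∨ v.IsCritical)
    {S : Set (ℤ × ℤ × ℤ)} (hS : SpansSubmodule v S) {w : ℤ × ℤ × ℤ} (hw : w ∈ S) (n : ℕ) :
    moveK w (-(n : ℤ)) ∈ S := by
  induction n with
  | zero => simpa using hw
  | succ n ih =>
    by_contra h
    have h2 := hS .e21 _ ih _ h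
    rw [act_e21 v hv, moveK_moveK] at h2
    have h3 : -((n + 1 : ℕ) : ℤ) = -(n : ℤ) + -1 := by push_cast; ring
    rw [h3, Finsupp.single_eq_same] at h2
    exact one_ne_zero h2

/-- A coefficient leaving `addN S` that is nonzero at `x` is nonzero at almost all `-n`, being
polynomial. Translated by `-n δ^{11}`, it would leave `S` in `V(T(v))`. -/
theorem SpansSubmodule.addN {v : Tableau} (hv : v.IsGeneric ∨ v.IsCritical)
    {S : Set (ℤ × ℤ × ℤ)} (hS : SpansSubmodule v S) (x : ℂ) :
    SpansSubmodule (v.shift11 x) (addN S) := by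
  intro g w hw w' hw'
  by_contra hne
  obtain ⟨n₀, hn₀⟩ := (isPolyFun_act v g w w').eventually_ne hne
  obtain ⟨t, ht⟩ := mem_addN_iff.1 hw
  have h1 : moveK w (-((t + n₀ : ℕ) : ℤ)) ∈ S := by
    have := hS.moveK_mem hv ht n₀
    rw [moveK_moveK] at this
    convert this using 2
    push_cast; ring
  have h2 := hn₀ (t + n₀) (by omega)
  have h3 : (-((t + n₀ : ℕ) : ℂ)) = ((-((t + n₀ : ℕ) : ℤ) : ℤ) : ℂ) := by push_cast; ring
  rw [h3, ← act_moveK] at h2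
  refine h2 (hS g _ h1 _ fun h4 => hw' (mem_addN_iff.2 ⟨_, h4⟩))

theorem addN_diff {v : Tableau} (hv : v.IsGeneric ∨ v.IsCritical) {S₁ S₂ : Set (ℤ × ℤ × ℤ)}
    (h₂ : SpansSubmodule v S₂)
    (h : ∀ w ∈ S₁ \ S₂, moveK w (-1) ∈ S₁ \ S₂) : addN (S₁ \ S₂) = addN S₁ \ addN S₂ := by
  have hd : ∀ n : ℕ, ∀ w ∈ S₁ \ S₂, moveK w (-(n : ℤ)) ∈ S₁ \ S₂ := by
    intro n w hw
    induction n with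
    | zero => simpa using hw
    | succ n ih =>
      have := h _ ih
      rw [moveK_moveK] at this
      convert this using 2
      push_cast; ring
  ext w
  constructor
  · rintro ⟨t, ht⟩
    refine ⟨⟨t, ht.1⟩, ?_⟩
    rintro ⟨s, hs⟩
    -- Going down `t + s` steps from `w` leads to a point of `S₁ \ S₂` by one route and of `S₂` by
    -- the other.
    have h3 := hd s _ ht
    have h4 := h₂.moveK_mem hv hs t
    refine h3.2 ?_
    convert h4 using 1
    ext <;> simp
    ring
  · rintro ⟨⟨t, ht⟩, hw⟩
    exact ⟨t, ht, fun h => hw ⟨t, h⟩⟩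

/-! ### The localized module, its twists and their weight spaces. -/

/-- The canonical map `U → D_12 U`. -/
noncomputable def numerator : U →ₐ[ℂ] DU :=
  { (OreLocalization.numeratorRingHom : U →+* DU) with
    commutes' := fun c => by
      let ν : U →+* DU := OreLocalization.numeratorRingHom
      change ν _ = _
      have h : ν (c • (1 : U)) * 1 = c • 1 :=
        OreLocalization.smul_one_oreDiv_one_smul (S := Submonoid.powers E21) c (1 : DU)
      rw [Algebra.algebraMap_eq_smul_one, Algebra.algebraMap_eq_smul_one, ← h, mul_one] }

theorem numerator_E21 : numerator E21 = (unitE21 : DU) := rfl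

theorem Θ_apply (x : ℂ) (a : DU) : Θ x a = thetaFun unitE21 x a := rfl

theorem Θ_sub_intCast (x : ℂ) (n : ℤ) (a : DU) : Θ x a =
    ((unitE21 ^ n : DUˣ) : DU) * Θ (x - n) a * ((unitE21 ^ (-n) : DUˣ) : DU) := by
  have := thetaFun_add_intCast unitE21 adE_unitE21_nilp (x - n) n a
  rwa [sub_add_cancel] at this

theorem Θ_Θ_neg (x : ℂ) (a : DU) : Θ x (Θ (-x) a) = a :=
  thetaFun_thetaFun_neg unitE21 adE_unitE21_nilp x a

theorem Θ_zero (a : DU) : Θ 0 a = a := thetaFun_zero unitE21 adE_unitE21_nilp a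

/-- On generators: `c_{mk}` with `m ≥ 2` commutes with `E_21` and is fixed, while `c_{11} = E_11`
becomes `E_11 + x`. -/
theorem Θ_numerator_mem (x : ℂ) (γ : gtSubalgebra) :
    ∃ δ : gtSubalgebra, Θ x (numerator γ) = numerator δ := by
  have h : gtSubalgebra ≤ (gtSubalgebra.map numerator).comap ((Θ x).comp numerator) := by
    rw [gtSubalgebra, Algebra.adjoin_le_iff, ← gtSubalgebra]
    rintro _ ⟨m, k, hk, hm, rfl⟩
    have hmem : gtGen m k ∈ gtSubalgebra := Algebra.subset_adjoin ⟨m, k, hk, hm, rfl⟩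
    rcases Nat.lt_or_ge 1 m with h1 | h1
    · refine ⟨gtGen m k, hmem, ?_⟩
      change numerator _ = Θ x (numerator _)
      rw [Θ_apply, thetaFun_of_commute]
      rw [← numerator_E21, ← map_mul, ← map_mul]
      exact congrArg _ (commute_E_gtGen m k (by omega) 1 0 h1 (by simp; omega)).eq
    · obtain ⟨rfl, rfl⟩ : m = 1 ∧ k = 0 := by omega
      refine ⟨gtGen 1 0 + algebraMap ℂ U x, gtSubalgebra.add_mem hmem (gtSubalgebra.algebraMap_mem _), ?_⟩
      change numerator _ = Θ x (numerator _)
      rw [Θ_apply, thetaFun_of_sub_eq, map_add, AlgHom.commutes]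
      rw [← numerator_E21, ← map_mul, ← map_mul, ← map_sub, gtGen_zero_eq, E_mul_sub_E_mul]
      simp
  obtain ⟨δ, hδ, h2⟩ := h γ.2
  exact ⟨⟨δ, hδ⟩, h2.symm⟩

section Localization

variable {L : Type*} [AddCommGroup L] [Module U L]

theorem numerator_smul (u : U) (y : D12 L) : numerator u • y = u • y :=
  OreLocalization.oreDiv_one_smul u y

theorem numerator_smul_toD12 (u : U) (l : L) : numerator u • toD12 L l = toD12 L (u • l) := by
  rw [numerator_smul, map_smul]

theorem toD12_injective (hinj : Function.Injective fun l : L => E21 • l) :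
    Function.Injective (toD12 L) := by
  intro l l' h
  obtain ⟨⟨_, k, rfl⟩, u, h1, h2⟩ := OreLocalization.oreDiv_eq_iff.1 h
  have h3 : E21 ^ k = u := by simpa using h2
  subst h3
  have h4 : ∀ n : ℕ, Function.Injective fun l : L => E21 ^ n • l := by
    intro n
    induction n with
    | zero => intro a b h; simpa using h
    | succ n ih =>
      intro a b h
      simp only [pow_succ, mul_smul] at h
      exact hinj (ih h)
  exact (h4 k h1).symm

variable [Module ℂ L] [IsScalarTower ℂ U L]

variable (L) in
/-- The action of `f^n`, `n ∈ ℤ`, on `D_12 L`. -/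
noncomputable def fPow (n : ℤ) : D12 L →ₗ[ℂ] D12 L :=
  Algebra.lsmul ℂ ℂ (D12 L) ((unitE21 ^ n : DUˣ) : DU)

theorem fPow_apply (n : ℤ) (y : D12 L) : fPow L n y = ((unitE21 ^ n : DUˣ) : DU) • y := rfl

theorem fPow_fPow (m n : ℤ) (y : D12 L) : fPow L m (fPow L n y) = fPow L (m + n) y := by
  simp only [fPow_apply, smul_smul, ← Units.val_mul, zpow_add]

theorem fPow_zero (y : D12 L) : fPow L 0 y = y := by simp [fPow_apply]

theorem fPow_injective (n : ℤ) : Function.Injective (fPow L n) := by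
  intro y y' h
  simpa [fPow_fPow, fPow_zero] using congrArg (fPow L (-n)) h

theorem fPow_one_toD12 (l : L) : fPow L 1 (toD12 L l) = toD12 L (E21 • l) := by
  rw [← numerator_smul_toD12, fPow_apply, zpow_one, numerator_E21]

/-- Moving `f^n` to the left shifts the twist by `n`; for `x = n` this returns to the untwisted
action. -/
theorem Θ_smul_fPow (x : ℂ) (a : DU) (n : ℤ) (y : D12 L) :
    Θ x a • fPow L n y = fPow L n (Θ (x - n) a • y) := by
  rw [Θ_sub_intCast x n]
  simp only [fPow_apply, smul_smul]
  rw [mul_assoc, ← Units.val_mul, ← zpow_add]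
  simp

theorem exists_eq_fPow (y : D12 L) : ∃ (t : ℕ) (l : L), y = fPow L (-(t : ℤ)) (toD12 L l) := by
  induction y using OreLocalization.ind with
  | _ r s =>
    obtain ⟨_, k, rfl⟩ := s
    refine ⟨k, r, fPow_injective k ?_⟩
    rw [fPow_fPow, add_neg_cancel, fPow_zero, fPow_apply, zpow_natCast, Units.val_pow_eq_pow_val,
      ← numerator_E21, ← map_pow]
    exact OreLocalization.smul_cancel (s := (⟨E21 ^ k, k, rfl⟩ : Submonoid.powers E21)) (t := 1)

theorem smul_toTwist_U (x : ℂ) (u : U) (y : D12 L) :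
    u • toTwist x (D12 L) y = toTwist x (D12 L) (Θ x (numerator u) • y) := rfl

variable (L) in
/-- `D_12^n L` and `D_12 L` are isomorphic for integers `n`. -/
noncomputable def twistIntEquiv (n : ℤ) : D12x L (n : ℂ) ≃ₗ[DU] D12 L where
  toFun y := fPow L (-n) ((toTwist (n : ℂ) (D12 L)).symm y)
  invFun y := toTwist (n : ℂ) (D12 L) (fPow L n y)
  map_add' y z := by simp
  map_smul' a y := by
    change fPow L (-n) (Θ n a • ((toTwist (n : ℂ) (D12 L)).symm y)) = a • fPow L (-n) _
    have h := Θ_smul_fPow (L := L) 0 a (-n) ((toTwist (n : ℂ) (D12 L)).symm y)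
    rw [Θ_zero] at h
    rw [h]
    simp
  left_inv y := by simp [fPow_fPow, fPow_zero]
  right_inv y := by simp [fPow_fPow, fPow_zero]

variable (L) in
/-- `D_12^0 L` and `D_12 L` are isomorphic. -/
noncomputable def twistZeroEquiv : D12x L 0 ≃ₗ[U] D12 L :=
  { (toTwist (0 : ℂ) (D12 L)).symm with
    map_smul' := fun u y => by
      change Θ 0 (numerator u) • ((toTwist (0 : ℂ) (D12 L)).symm y) = _
      rw [Θ_zero, numerator_smul]
      rfl }

/-! ### Gelfand-Tsetlin modules -/

/-- A nonzero vector lies in only one generalized eigenspace of an operator, so a weight that occurs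
depends only on the action of `Γ`. -/
theorem eq_of_mem_gtSpace {χ : gtSubalgebra →ₐ[ℂ] ℂ} {l : L} (hl : l ∈ gtSpace L χ) (h0 : l ≠ 0)
    {γ δ : gtSubalgebra} (h : ∀ m : L, (γ : U) • m = (δ : U) • m) : χ γ = χ δ := by
  by_contra hne
  have h1 : l ∈ (Algebra.lsmul ℂ ℂ L (γ : U) : Module.End ℂ L).maxGenEigenspace (χ γ) :=
    (Submodule.mem_iInf _).1 hl γ
  have h2 : l ∈ (Algebra.lsmul ℂ ℂ L (δ : U) : Module.End ℂ L).maxGenEigenspace (χ δ) :=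
    (Submodule.mem_iInf _).1 hl δ
  have h3 : (Algebra.lsmul ℂ ℂ L (δ : U) : Module.End ℂ L) = Algebra.lsmul ℂ ℂ L (γ : U) := by
    ext m; simp [h]
  rw [h3] at h2
  exact h0 (Submodule.disjoint_def.1 (Module.End.disjoint_genEigenspace _ hne ⊤ ⊤) l h1 h2)

theorem toTwist_fPow_mem_iSup_gtSpace (hinj : Function.Injective fun l : L => E21 • l) (x : ℂ)
    (n : ℤ) {χ : gtSubalgebra →ₐ[ℂ] ℂ} {l : L} (hl : l ∈ gtSpace L χ) :
    toTwist x (D12 L) (fPow L n (toD12 L l)) ∈ ⨆ χ, gtSpace (D12x L x) χ := by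
  by_cases h0 : l = 0
  · simp [h0]
  choose σ hσ using Θ_numerator_mem (x - n)
  have huniq : ∀ γ δ : gtSubalgebra, numerator (γ : U) = numerator δ → χ γ = χ δ := by
    intro γ δ h
    refine eq_of_mem_gtSpace hl h0 fun m => toD12_injective hinj ?_
    rw [← numerator_smul_toD12, h, numerator_smul_toD12]
  -- The new weight is `χ ∘ Θ_{x-n}`. The lift `σ` is an arbitrary choice, but `huniq` makes `χ ∘ σ`
  -- independent of it, hence multiplicative and linear.
  let χ' : gtSubalgebra →ₐ[ℂ] ℂ :=
    { toFun := fun γ => χ (σ γ)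
      map_one' := by rw [← map_one χ]; apply huniq; rw [← hσ]; simp
      map_zero' := by rw [← map_zero χ]; apply huniq; rw [← hσ]; simp
      map_mul' := fun a c => by rw [← map_mul χ]; apply huniq; rw [← hσ]; simp [hσ]
      map_add' := fun a c => by rw [← map_add χ]; apply huniq; rw [← hσ]; simp [hσ]
      commutes' := fun c => by rw [← AlgHom.commutes χ c]; apply huniq; rw [← hσ]; simp }
  refine Submodule.mem_iSup_of_mem χ' (map_mem_gtSpace
    ((toTwist x (D12 L)).toLinearMap ∘ₗ fPow L n ∘ₗ (toD12 L).restrictScalars ℂ)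
    (fun γ => ⟨σ γ, rfl, fun m => ?_⟩) hl)
  change (γ : U) • toTwist x (D12 L) (fPow L n (toD12 L m)) =
    toTwist x (D12 L) (fPow L n (toD12 L ((σ γ : U) • m)))
  rw [smul_toTwist_U, Θ_smul_fPow, hσ, numerator_smul_toD12]

theorem iSup_gtSpace_twist (hinj : Function.Injective fun l : L => E21 • l)
    (hL : ⨆ χ, gtSpace L χ = ⊤) (x : ℂ) : ⨆ χ, gtSpace (D12x L x) χ = ⊤ := by
  rw [eq_top_iff]
  intro y _
  obtain ⟨t, l, h⟩ := exists_eq_fPow ((toTwist x (D12 L)).symm y)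
  obtain rfl : y = toTwist x (D12 L) (fPow L (-(t : ℤ)) (toD12 L l)) := by rw [← h]; simp
  have hle : ⨆ χ, gtSpace L χ ≤ (⨆ χ, gtSpace (D12x L x) χ).comap
      ((toTwist x (D12 L)).toLinearMap ∘ₗ fPow L (-(t : ℤ)) ∘ₗ (toD12 L).restrictScalars ℂ) :=
    iSup_le fun χ m hm => toTwist_fPow_mem_iSup_gtSpace hinj x _ hm
  exact hle (by rw [hL]; trivial)

/-- A `U`-submodule spanned by a set stable under `f^{-1}` is stable under `f^{-1}`. -/
theorem fPow_neg_one_mem_span (x : ℂ) (S : Set (D12x L x))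
    (hS : ∀ y : D12 L, toTwist x (D12 L) y ∈ S → toTwist x (D12 L) (fPow L (-1) y) ∈ S)
    (y : D12 L) (hy : toTwist x (D12 L) y ∈ Submodule.span U S) :
    toTwist x (D12 L) (fPow L (-1) y) ∈ Submodule.span U S := by
  -- Induction on the nilpotency order of `u` through `f⁻¹ u = u f⁻¹ - f⁻¹ [f, u] f⁻¹`, where `[f,
  -- u]` has smaller order and `Θ_x` fixes `f`.
  have key : ∀ (n : ℕ) (u : U), (adE E21 ^ n) u = 0 → ∀ y, toTwist x (D12 L) y ∈ S →
      toTwist x (D12 L) (fPow L (-1) (Θ x (numerator u) • y)) ∈ Submodule.span U S := by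
    intro n
    induction n with
    | zero =>
      intro u hu y _
      have : u = 0 := by simpa using hu
      simp [this]
    | succ n ih =>
      intro u hu y hy
      have h1 := ih (adE E21 u) (by rwa [pow_succ] at hu) _ (hS y hy)
      have h2 := (Submodule.span U S).smul_mem u (Submodule.subset_span (hS y hy))
      have h3 : (unitE21 : DU) * Θ x (numerator u) - Θ x (numerator u) * unitE21 =
          Θ x (numerator (adE E21 u)) := by
        have h4 : Θ x (unitE21 : DU) = unitE21 := thetaFun_of_commute unitE21 x rfl
        rw [adE_apply, map_sub, map_mul, map_mul, numerator_E21, map_sub, map_mul, map_mul, h4]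
      have h5 : fPow L (-1) (Θ x (numerator u) • y) = Θ x (numerator u) • fPow L (-1) y -
          fPow L (-1) (Θ x (numerator (adE E21 u)) • fPow L (-1) y) := by
        have h6 : ((unitE21 ^ (-1 : ℤ) : DUˣ) : DU) * Θ x (numerator u) =
            Θ x (numerator u) * ((unitE21 ^ (-1 : ℤ) : DUˣ) : DU) -
            ((unitE21 ^ (-1 : ℤ) : DUˣ) : DU) * (Θ x (numerator (adE E21 u)) *
            ((unitE21 ^ (-1 : ℤ) : DUˣ) : DU)) := by
          rw [← h3]
          simp [sub_mul, mul_sub, mul_assoc]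
        simp only [fPow_apply, smul_smul, ← sub_smul, h6]
      rw [h5, map_sub, ← smul_toTwist_U]
      exact sub_mem h2 h1
  suffices h : ∀ z ∈ Submodule.span U S, toTwist x (D12 L)
      (fPow L (-1) ((toTwist x (D12 L)).symm z)) ∈ Submodule.span U S by
    simpa using h _ hy
  intro z hz
  induction hz using Submodule.closure_induction with
  | zero => simp
  | add a c _ _ ha hc => simpa using add_mem ha hc
  | smul_mem u z hz =>
    obtain ⟨n, hn⟩ := adE_E21_nilp u
    exact key n u hn ((toTwist x (D12 L)).symm z) hz

end Localization

/-! ### The tableaux basis of the localization and the twisted action on it. -/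

section Tableaux

variable {L : Type*} [AddCommGroup L] [Module ℂ L] [Module U L] [IsScalarTower ℂ U L]
  {B : Set (ℤ × ℤ × ℤ)}

/-- Otherwise the only term of `E_21 Tab(w)` would be omitted and `E_21` would kill a basis vector.
-/
theorem IsTableauxBasis.moveK_mem {v : Tableau} (hv : v.IsGeneric ∨ v.IsCritical)
    {b : Module.Basis B ℂ L} (hb : IsTableauxBasis B v b)
    (hinj : Function.Injective fun l : L => E21 • l) : ∀ w ∈ B, moveK w (-1) ∈ B := by
  intro w hw
  by_contra h
  have h0 : E21 • b ⟨w, hw⟩ = 0 := by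
    apply b.repr.injective
    ext w'
    have h1 := hb.action .e21 ⟨w, hw⟩ w'
    rw [act_e21 v hv, Finsupp.single_eq_of_ne (by rintro h2; exact h (h2 ▸ w'.2))] at h1
    rw [map_zero]
    exact h1
  exact b.ne_zero _ (hinj (h0.trans (smul_zero E21).symm))

theorem IsTableauxBasis.E21_smul {v : Tableau} (hv : v.IsGeneric ∨ v.IsCritical)
    {b : Module.Basis B ℂ L} (hb : IsTableauxBasis B v b) (w : B) (h : moveK w (-1) ∈ B) :
    E21 • b w = b ⟨moveK w (-1), h⟩ := by
  apply b.repr.injective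
  ext w'
  have h1 := hb.action .e21 w w'
  rw [act_e21 v hv] at h1
  rw [Module.Basis.repr_self]
  refine h1.trans ?_
  classical
  simp only [Finsupp.single_apply, Subtype.ext_iff]

theorem moveK_natCast_mem (hB : ∀ w ∈ B, moveK w (-1) ∈ B) (n : ℕ) {w : ℤ × ℤ × ℤ} (hw : w ∈ B) :
    moveK w (-(n : ℤ)) ∈ B := by
  induction n with
  | zero => simpa using hw
  | succ n ih =>
    have := hB _ ih
    rw [moveK_moveK] at this
    convert this using 2
    push_cast; ring

theorem moveK_mem_addN (hB : ∀ w ∈ B, moveK w (-1) ∈ B) (k : ℤ) {w : ℤ × ℤ × ℤ}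
    (hw : w ∈ addN B) : moveK w k ∈ addN B := by
  obtain ⟨t, ht⟩ := mem_addN_iff.1 hw
  -- The sum is nonnegative and leads down to `w - (t + |k|) δ^{11}`, which lies in `B`.
  refine mem_addN_iff.2 ⟨(t + k.natAbs + k).toNat, ?_⟩
  have := moveK_natCast_mem hB k.natAbs ht
  rw [moveK_moveK] at this ⊢
  convert this using 2
  omega

theorem fPow_toD12_basis {b : Module.Basis B ℂ L}
    (hf : ∀ (w : B) (h : moveK w (-1) ∈ B), E21 • b w = b ⟨moveK w (-1), h⟩)
    (hB : ∀ w ∈ B, moveK w (-1) ∈ B) (n : ℕ) (w : B) (h : moveK w (-(n : ℤ)) ∈ B) :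
    fPow L n (toD12 L (b w)) = toD12 L (b ⟨moveK w (-(n : ℤ)), h⟩) := by
  induction n with
  | zero => simp [fPow_zero]
  | succ n ih =>
    have h1 := moveK_natCast_mem hB n w.2
    have h2 : ((n + 1 : ℕ) : ℤ) = 1 + n := by push_cast; ring
    simp only [h2]
    rw [← fPow_fPow, ih h1, fPow_one_toD12, hf _ (hB _ h1)]
    congr 3
    rw [moveK_moveK]
    congr 1
    ring

/-- The tableaux basis of `D_12 L`. -/
theorem exists_basis_D12 {b : Module.Basis B ℂ L}
    (hf : ∀ (w : B) (h : moveK w (-1) ∈ B), E21 • b w = b ⟨moveK w (-1), h⟩)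
    (hB : ∀ w ∈ B, moveK w (-1) ∈ B) (hinj : Function.Injective fun l : L => E21 • l) :
    ∃ bD : Module.Basis (addN B) ℂ (D12 L), ∀ (w : addN B) (t : ℕ) (h : moveK w (-(t : ℤ)) ∈ B),
      fPow L t (bD w) = toD12 L (b ⟨moveK w (-(t : ℤ)), h⟩) := by
  choose t ht using fun w : addN B => mem_addN_iff.1 w.2
  let e : addN B → D12 L := fun w => fPow L (-(t w : ℤ)) (toD12 L (b ⟨_, ht w⟩))
  -- The vector `e w` does not depend on the chosen depth `t w`: applying `f^{t w}` compares it with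
  -- any other depth.
  have he : ∀ (w : addN B) (s : ℕ) (h : moveK w (-(s : ℤ)) ∈ B),
      fPow L s (e w) = toD12 L (b ⟨moveK w (-(s : ℤ)), h⟩) := by
    intro w s h
    apply fPow_injective (t w : ℤ)
    rw [fPow_toD12_basis hf hB _ _ (moveK_natCast_mem hB _ h), fPow_fPow, fPow_fPow]
    have h1 : (t w : ℤ) + s + -(t w : ℤ) = s := by ring
    rw [h1, fPow_toD12_basis hf hB _ _ (moveK_natCast_mem hB _ (ht w))]
    congr 3
    rw [moveK_moveK, moveK_moveK, add_comm]
  have hli : LinearIndependent ℂ e := by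
    rw [linearIndependent_iff']
    intro s g hg i hi
    -- One common power of `f` pushes a finite linear relation into `L`, where the translated basis
    -- vectors are still distinct.
    have hT : ∀ j : s, moveK (j : addN B) (-((s.sup t : ℕ) : ℤ)) ∈ B := by
      intro j
      have h1 : t j ≤ s.sup t := Finset.le_sup j.2
      have h2 := moveK_natCast_mem hB (s.sup t - t j) (ht j)
      rw [moveK_moveK] at h2
      convert h2 using 2
      omega
    let σ : s → B := fun j => ⟨_, hT j⟩
    have hσ : Function.Injective σ := fun j j' h =>
      Subtype.ext (Subtype.ext (moveK_injective _ (congrArg Subtype.val h)))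
    have h1 : ∑ j ∈ s.attach, g j • b (σ j) = 0 := by
      apply toD12_injective hinj
      rw [map_zero, map_sum]
      have h2 := congrArg (fPow L ((s.sup t : ℕ) : ℤ)) hg
      rw [map_zero, map_sum, ← s.sum_attach] at h2
      rw [← h2]
      refine Finset.sum_congr rfl fun j _ => ?_
      rw [(fPow L _).map_smul, he _ _ (hT j)]
      exact ((toD12 L).restrictScalars ℂ).map_smul _ _
    exact linearIndependent_iff'.1 (b.linearIndependent.comp σ hσ) s.attach (fun j => g j) h1
      ⟨i, hi⟩ (Finset.mem_attach _ _)
  have hsp : ⊤ ≤ Submodule.span ℂ (Set.range e) := by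
    intro y _
    obtain ⟨n, l, rfl⟩ := exists_eq_fPow y
    have hle : ⊤ ≤ (Submodule.span ℂ (Set.range e)).comap
        (fPow L (-(n : ℤ)) ∘ₗ (toD12 L).restrictScalars ℂ) := by
      rw [← b.span_eq, Submodule.span_le]
      rintro _ ⟨w, rfl⟩
      have h1 : moveK (moveK w n) (-(n : ℤ)) ∈ B := by simp
      refine Submodule.subset_span ⟨⟨moveK w n, n, h1⟩, ?_⟩
      apply fPow_injective (n : ℤ)
      rw [he _ n h1]
      change _ = fPow L n (fPow L (-(n : ℤ)) (toD12 L (b w)))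
      rw [fPow_fPow, add_neg_cancel, fPow_zero]
      congr 2
      ext1
      simp
    exact hle trivial
  exact ⟨Module.Basis.mk hli hsp, fun w s h => by simpa using he w s h⟩

variable {b : Module.Basis B ℂ L} {bD : Module.Basis (addN B) ℂ (D12 L)}

theorem basis_D12_of_mem
    (hbD : ∀ (w : addN B) (t : ℕ) (h : moveK w (-(t : ℤ)) ∈ B),
      fPow L t (bD w) = toD12 L (b ⟨moveK w (-(t : ℤ)), h⟩))
    (w : addN B) (h : (w : ℤ × ℤ × ℤ) ∈ B) : bD w = toD12 L (b ⟨w, h⟩) := by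
  simpa [fPow_zero] using hbD w 0 (by simpa using h)

theorem fPow_basis_D12
    (hbD : ∀ (w : addN B) (t : ℕ) (h : moveK w (-(t : ℤ)) ∈ B),
      fPow L t (bD w) = toD12 L (b ⟨moveK w (-(t : ℤ)), h⟩))
    (hB : ∀ w ∈ B, moveK w (-1) ∈ B)
    (n : ℤ) (w : addN B) :
    fPow L n (bD w) = bD ⟨moveK w (-n), moveK_mem_addN hB _ w.2⟩ := by
  obtain ⟨t, ht⟩ := mem_addN_iff.1 w.2
  have h1 := moveK_natCast_mem hB n.natAbs ht
  rw [moveK_moveK] at h1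
  obtain ⟨s, hs⟩ : ∃ s : ℕ, (s : ℤ) = t + n.natAbs - n := ⟨(t + n.natAbs - n).toNat, by omega⟩
  have h2 : moveK w (-((t + n.natAbs : ℕ) : ℤ)) ∈ B := by
    convert h1 using 2; push_cast; ring
  have h3 : moveK (moveK w (-n)) (-(s : ℤ)) ∈ B := by
    rw [moveK_moveK]; convert h1 using 2; omega
  apply fPow_injective (s : ℤ)
  have h4 : (s : ℤ) + n = ((t + n.natAbs : ℕ) : ℤ) := by omega
  rw [fPow_fPow, h4, hbD _ _ h2, hbD _ s h3]
  congr 3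
  rw [moveK_moveK]
  congr 1
  omega

theorem repr_fPow
    (hbD : ∀ (w : addN B) (t : ℕ) (h : moveK w (-(t : ℤ)) ∈ B),
      fPow L t (bD w) = toD12 L (b ⟨moveK w (-(t : ℤ)), h⟩))
    (hB : ∀ w ∈ B, moveK w (-1) ∈ B)
    (n : ℤ) (y : D12 L) (w : addN B) :
    bD.repr (fPow L n y) w = bD.repr y ⟨moveK w n, moveK_mem_addN hB _ w.2⟩ := by
  classical
  have h : Finsupp.lapply w ∘ₗ bD.repr.toLinearMap ∘ₗ fPow L n =
      Finsupp.lapply ⟨moveK w n, moveK_mem_addN hB _ w.2⟩ ∘ₗ bD.repr.toLinearMap := by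
    refine bD.ext fun a => ?_
    change bD.repr (fPow L n (bD a)) w = bD.repr (bD a) _
    rw [fPow_basis_D12 hbD hB, Module.Basis.repr_self, Module.Basis.repr_self,
      Finsupp.single_apply, Finsupp.single_apply]
    congr 1
    rw [Subtype.ext_iff, Subtype.ext_iff, ← (moveK_injective n).eq_iff]
    simp
  exact DFunLike.congr_fun h y

theorem repr_toD12
    (hbD : ∀ (w : addN B) (t : ℕ) (h : moveK w (-(t : ℤ)) ∈ B),
      fPow L t (bD w) = toD12 L (b ⟨moveK w (-(t : ℤ)), h⟩))
    (l : L) (w : addN B) (hw : (w : ℤ × ℤ × ℤ) ∈ B) :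
    bD.repr (toD12 L l) w = b.repr l ⟨w, hw⟩ := by
  classical
  have h : Finsupp.lapply w ∘ₗ bD.repr.toLinearMap ∘ₗ (toD12 L).restrictScalars ℂ =
      Finsupp.lapply ⟨w, hw⟩ ∘ₗ b.repr.toLinearMap := by
    refine b.ext fun a => ?_
    change bD.repr (toD12 L (b a)) w = b.repr (b a) _
    rw [← basis_D12_of_mem hbD ⟨a, mem_addN a.2⟩ a.2, Module.Basis.repr_self,
      Module.Basis.repr_self, Finsupp.single_apply, Finsupp.single_apply]
    congr 1
    rw [Subtype.ext_iff, Subtype.ext_iff]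
  exact DFunLike.congr_fun h l

/-- The interpolation step. At `x = -n`, writing `bD w = f^{-n} l` turns `Θ_{-n}(u)` into the plain
action of `u` on `l ∈ L`, which `hb` describes. -/
theorem repr_Θ_smul {v : Tableau}
    (hbD : ∀ (w : addN B) (t : ℕ) (h : moveK w (-(t : ℤ)) ∈ B),
      fPow L t (bD w) = toD12 L (b ⟨moveK w (-(t : ℤ)), h⟩))
    (hB : ∀ w ∈ B, moveK w (-1) ∈ B)
    (hb : IsTableauxBasis B v b) (x : ℂ) (g : Gen) (w w' : addN B) :
    bD.repr (Θ x (numerator g.toU) • bD w) w' = act (v.shift11 x) g w w' := by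
  have h1 : IsPolyFun fun x => bD.repr (Θ x (numerator g.toU) • bD w) w' :=
    isPolyFun_thetaFun unitE21 adE_unitE21_nilp (Finsupp.lapply w' ∘ₗ bD.repr.toLinearMap ∘ₗ
      (Algebra.lsmul ℂ ℂ (D12 L)).toLinearMap.flip (bD w)) (numerator g.toU)
  obtain ⟨t, ht⟩ := mem_addN_iff.1 w.2
  obtain ⟨t', ht'⟩ := mem_addN_iff.1 w'.2
  -- From depth `t + t'` on, both indices have moved into `B`.
  refine congrFun (h1.eq_of_frequently (isPolyFun_act v g w w') (t + t') fun n hn => ?_) x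
  have hw : moveK w (-(n : ℤ)) ∈ B := by
    have := moveK_natCast_mem hB (n - t) ht
    rw [moveK_moveK] at this
    convert this using 2; omega
  have hw' : moveK w' (-(n : ℤ)) ∈ B := by
    have := moveK_natCast_mem hB (n - t') ht'
    rw [moveK_moveK] at this
    convert this using 2; omega
  have h2 : (-(n : ℂ)) = ((-(n : ℤ) : ℤ) : ℂ) := by push_cast; ring
  have h3 : bD w = fPow L (-(n : ℤ)) (toD12 L (b ⟨_, hw⟩)) := by
    rw [← hbD, fPow_fPow, neg_add_cancel, fPow_zero]
  rw [h3, Θ_smul_fPow, h2, sub_self, Θ_zero, numerator_smul_toD12, repr_fPow hbD hB,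
    repr_toD12 hbD _ _ hw', hb.action, act_moveK]

end Tableaux

/-! ### Finite generation and assembly. -/

section Finiteness

variable {L : Type*} [AddCommGroup L] [Module ℂ L] [Module U L] [IsScalarTower ℂ U L]

theorem smul_mem_of_fPow_neg_one_mem (x : ℂ) (N : Submodule U (D12x L x))
    (hN : ∀ y, toTwist x (D12 L) y ∈ N → toTwist x (D12 L) (fPow L (-1) y) ∈ N)
    (a : DU) (y : D12 L) (hy : toTwist x (D12 L) y ∈ N) : toTwist x (D12 L) (a • y) ∈ N := by
  have hN' : ∀ (n : ℕ) (y : D12 L), toTwist x (D12 L) y ∈ N →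
      toTwist x (D12 L) (fPow L (-(n : ℤ)) y) ∈ N := by
    intro n
    induction n with
    | zero => intro y hy; simpa [fPow_zero] using hy
    | succ n ih =>
      intro y hy
      have := hN _ (ih y hy)
      rw [fPow_fPow] at this
      convert this using 4
      push_cast; ring
  -- Write `a = Θ_x(c)` with `f^k c = r ∈ U`. Then `a = f^{-k} Θ_x(r)`, and both factors preserve
  -- `N`.
  rw [← Θ_Θ_neg x a]
  generalize Θ (-x) a = c
  induction c using OreLocalization.ind with
  | _ r s =>
    obtain ⟨_, k, rfl⟩ := s
    have h1 : (unitE21 : DU) ^ k * (r /ₒ (⟨E21 ^ k, k, rfl⟩ : Submonoid.powers E21)) =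
        numerator r := by
      rw [← numerator_E21, ← map_pow]
      exact OreLocalization.mul_cancel (s := (⟨E21 ^ k, k, rfl⟩ : Submonoid.powers E21)) (t := 1)
    have h2 : Θ x (unitE21 : DU) = unitE21 := thetaFun_of_commute unitE21 x rfl
    have h3 := congrArg (Θ x) h1
    rw [map_mul, map_pow, h2] at h3
    have h4 := N.smul_mem r hy
    rw [smul_toTwist_U, ← h3] at h4
    have h5 := hN' k _ h4
    simpa only [fPow_apply, smul_smul, ← mul_assoc, ← zpow_natCast, ← Units.val_pow_eq_pow_val,
      ← Units.val_mul, ← zpow_add, neg_add_cancel, zpow_zero, Units.val_one, one_mul] using h5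

/-- Stability under `f^{-1}` makes `N` a `D_12 U`-submodule for the untwisted action as well. Its
trace on `L` is then a nonzero `U`-submodule, hence `L`, and `L` generates `D_12 L`. -/
theorem eq_top_of_fPow_neg_one_mem (hsimple : IsSimpleModule U L) (x : ℂ)
    (N : Submodule U (D12x L x))
    (hN : ∀ y, toTwist x (D12 L) y ∈ N → toTwist x (D12 L) (fPow L (-1) y) ∈ N)
    {l : L} (h0 : l ≠ 0) (hl : toTwist x (D12 L) (toD12 L l) ∈ N) : N = ⊤ := by
  have h := smul_mem_of_fPow_neg_one_mem x N hN
  let K : Submodule U L :=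
    { carrier := {m | toTwist x (D12 L) (toD12 L m) ∈ N}
      zero_mem' := by simp
      add_mem' := fun {m m'} hm hm' => by simpa using N.add_mem hm hm'
      smul_mem' := fun u m hm => by
        have := h (numerator u) _ hm
        rwa [numerator_smul_toD12] at this }
  have hK : K = ⊤ := by
    rcases eq_bot_or_eq_top K with h1 | h1
    · exact absurd ((Submodule.eq_bot_iff K).1 h1 l hl) h0
    · exact h1
  rw [eq_top_iff]
  intro y _
  obtain ⟨t, m, hm⟩ := exists_eq_fPow ((toTwist x (D12 L)).symm y)
  obtain rfl : y = toTwist x (D12 L) (fPow L (-(t : ℤ)) (toD12 L m)) := by rw [← hm]; simp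
  exact h _ _ (show m ∈ K by rw [hK]; trivial)

theorem exists_forall_ge_sub_ne (α : ℂ) : ∃ k₀ : ℤ, ∀ k : ℤ, k₀ ≤ k → α - k ≠ 0 := by
  by_cases h : ∃ k : ℤ, α = k
  · obtain ⟨k, rfl⟩ := h
    refine ⟨k + 1, fun l hl h => ?_⟩
    have : k = l := by exact_mod_cast sub_eq_zero.1 h
    omega
  · exact ⟨0, fun k _ hk => h ⟨k, sub_eq_zero.1 hk⟩⟩

variable {B : Set (ℤ × ℤ × ℤ)} {v : Tableau} {b : Module.Basis B ℂ L}
  {bD : Module.Basis (addN B) ℂ (D12 L)}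

theorem finite_twist (hv : v.IsGeneric ∨ v.IsCritical) (hsimple : IsSimpleModule U L)
    (hbD : ∀ (w : addN B) (t : ℕ) (h : moveK w (-(t : ℤ)) ∈ B),
      fPow L t (bD w) = toD12 L (b ⟨moveK w (-(t : ℤ)), h⟩))
    (hB : ∀ w ∈ B, moveK w (-1) ∈ B) (hb : IsTableauxBasis B v b) (x : ℂ) :
    Module.Finite U (D12x L x) := by
  have hv' : (v.shift11 x).IsGeneric ∨ (v.shift11 x).IsCritical := hv
  -- On a derivative tableau `E_12` also produces a multiple of the mirror regular tableau. Passing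
  -- to the mirror if it is present gives a line on which `E_12` is a scalar times a translation.
  obtain ⟨w, hw, hsw⟩ : ∃ w ∈ addN B, w.2.1 < w.1 → (w.2.1, w.1, w.2.2) ∉ addN B := by
    have := IsSimpleModule.nontrivial U L
    obtain ⟨w, hw⟩ := b.index_nonempty
    by_cases h : w.2.1 < w.1 ∧ (w.2.1, w.1, w.2.2) ∈ addN B
    · exact ⟨_, h.2, fun h' => absurd h.1 (not_lt.2 h'.le)⟩
    · exact ⟨w, mem_addN hw, fun h1 h2 => h ⟨h1, h2⟩⟩
  let e : ℤ → D12 L := fun k => bD ⟨moveK w k, moveK_mem_addN hB k hw⟩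
  have he : ∀ n k, fPow L n (e k) = e (k - n) := by
    intro n k
    simp only [e]
    rw [fPow_basis_D12 hbD hB]
    congr 2
    rw [moveK_moveK, sub_eq_add_neg]
  let q : ℤ → ℂ := fun k => -((v.v21 + w.1 - (v.v11 + x + (w.2.2 + k : ℤ))) *
    (v.v22 + w.2.1 - (v.v11 + x + (w.2.2 + k : ℤ))))
  have hE12 : ∀ k, Θ x (numerator (E 0 1)) • e k = q k • e (k + 1) := by
    intro k
    apply bD.repr.injective
    ext w'
    have h1 := repr_Θ_smul hbD hB hb x .e12 ⟨moveK w k, moveK_mem_addN hB k hw⟩ w'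
    refine h1.trans ?_
    classical
    rw [map_smul, Finsupp.smul_apply, Module.Basis.repr_self, Finsupp.single_apply]
    split_ifs with h2
    · rw [← h2]
      have h3 := act_e12_self (v.shift11 x) hv' (moveK w k)
      rw [moveK_moveK] at h3
      rw [h3]
      simp [q, Tableau.shift11]
    · rw [smul_zero]
      refine act_e12_eq_zero _ hv' _ _ ?_ ?_
      · intro h3
        rw [moveK_moveK] at h3
        exact h2 (Subtype.ext h3.symm)
      · intro h3 h4
        refine hsw h3 ?_
        have := moveK_mem_addN hB (-(k + 1)) w'.2
        rw [h4] at this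
        convert this using 1
        ext <;> simp
  obtain ⟨k₁, hk₁⟩ := exists_forall_ge_sub_ne (v.v21 + w.1 - (v.v11 + x + w.2.2))
  obtain ⟨k₂, hk₂⟩ := exists_forall_ge_sub_ne (v.v22 + w.2.1 - (v.v11 + x + w.2.2))
  -- Each factor of `q k` vanishes for at most one integer `k`. Starting above both roots, `E_12`
  -- climbs the line and `E_21` descends it without obstruction.
  have hq : ∀ k, max k₁ k₂ ≤ k → q k ≠ 0 := by
    intro k hk
    refine neg_ne_zero.2 (mul_ne_zero ?_ ?_)
    · convert hk₁ k (by omega) using 1; push_cast; ring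
    · convert hk₂ k (by omega) using 1; push_cast; ring
  let N : Submodule U (D12x L x) := Submodule.span U {toTwist x (D12 L) (e (max k₁ k₂))}
  have hmem : ∀ k, toTwist x (D12 L) (e k) ∈ N := by
    intro k
    rcases le_total (max k₁ k₂) k with hk | hk
    · induction k, hk using Int.leInduction with
      | base => exact Submodule.subset_span rfl
      | succ k hk ih =>
        have h1 := N.smul_mem (E 0 1) ih
        rw [smul_toTwist_U, hE12, map_smul] at h1
        have h2 := (N.restrictScalars ℂ).smul_mem (q k)⁻¹ h1
        rwa [inv_smul_smul₀ (hq k hk)] at h2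
    · induction k, hk using Int.leInductionDown with
      | base => exact Submodule.subset_span rfl
      | pred k hk ih =>
        have h1 := N.smul_mem E21 ih
        have h2 : Θ x (numerator E21) = (unitE21 : DU) := thetaFun_of_commute unitE21 x rfl
        have h3 := he 1 k
        rw [fPow_apply, zpow_one] at h3
        rwa [smul_toTwist_U, h2, h3] at h1
  let S : Set (D12x L x) := Set.range fun k => toTwist x (D12 L) (e k)
  have hNS : N = Submodule.span U S := by
    refine le_antisymm (Submodule.span_mono ?_) (Submodule.span_le.2 ?_)
    · rintro _ rfl; exact ⟨_, rfl⟩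
    · rintro _ ⟨k, rfl⟩; exact hmem k
  -- The single generator is replaced by the whole line, a generating set on which `f^{-1}` acts by
  -- translation.
  have hNf : ∀ y, toTwist x (D12 L) y ∈ N → toTwist x (D12 L) (fPow L (-1) y) ∈ N := by
    intro y hy
    rw [hNS] at hy ⊢
    refine fPow_neg_one_mem_span x S ?_ y hy
    rintro y ⟨k, hk⟩
    obtain rfl := (toTwist x (D12 L)).injective hk
    exact ⟨k - -1, by rw [he]⟩
  obtain ⟨t, ht⟩ := mem_addN_iff.1 hw
  have hl : toTwist x (D12 L) (toD12 L (b ⟨_, ht⟩)) ∈ N := by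
    have := hmem (-(t : ℤ))
    rwa [show e (-(t : ℤ)) = toD12 L (b ⟨_, ht⟩) from basis_D12_of_mem hbD _ ht] at this
  refine ⟨⟨{toTwist x (D12 L) (e (max k₁ k₂))}, ?_⟩⟩
  rw [Finset.coe_singleton]
  exact eq_top_of_fPow_neg_one_mem hsimple x N hNf (b.ne_zero _) hl

theorem isTableauxBasis_twist (hv : v.IsGeneric ∨ v.IsCritical) (hsimple : IsSimpleModule U L)
    (hinj : Function.Injective fun l : L => E21 • l)
    (hbD : ∀ (w : addN B) (t : ℕ) (h : moveK w (-(t : ℤ)) ∈ B),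
      fPow L t (bD w) = toD12 L (b ⟨moveK w (-(t : ℤ)), h⟩))
    (hB : ∀ w ∈ B, moveK w (-1) ∈ B) (hb : IsTableauxBasis B v b) (x : ℂ) :
    IsTableauxBasis (addN B) (v.shift11 x) (bD.map (toTwist x (D12 L))) where
  gelfandTsetlin := ⟨finite_twist hv hsimple hbD hB hb x, iSupIndep_gtSpace,
    iSup_gtSpace_twist hinj hb.gelfandTsetlin.2.2 x⟩
  subquotient := by
    obtain ⟨S₁, S₂, h₁, h₂, rfl⟩ := hb.subquotient
    exact ⟨addN S₁, addN S₂, h₁.addN hv x, h₂.addN hv x, addN_diff hv h₂ hB⟩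
  action g w w' := repr_Θ_smul hbD hB hb x g w w'

theorem range_toD12_eq_span (hbD : ∀ (w : addN B) (t : ℕ) (h : moveK w (-(t : ℤ)) ∈ B),
      fPow L t (bD w) = toD12 L (b ⟨moveK w (-(t : ℤ)), h⟩)) :
    (LinearMap.range (toD12 L)).restrictScalars ℂ =
      Submodule.span ℂ (bD '' {w | (w : ℤ × ℤ × ℤ) ∈ B}) := by
  have h1 : (LinearMap.range (toD12 L)).restrictScalars ℂ =
      LinearMap.range ((toD12 L).restrictScalars ℂ) := rfl
  rw [h1, ← Submodule.map_top, ← b.span_eq, Submodule.map_span]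
  congr 1
  ext y
  constructor
  · rintro ⟨_, ⟨w, rfl⟩, rfl⟩
    exact ⟨⟨w, mem_addN w.2⟩, w.2, basis_D12_of_mem hbD _ w.2⟩
  · rintro ⟨w, hw, rfl⟩
    exact ⟨_, ⟨⟨w, hw⟩, rfl⟩, (basis_D12_of_mem hbD w hw).symm⟩

end Finiteness

end GTsl3

theorem mainTheorem9 {L : Type*} [AddCommGroup L] [Module ℂ L] [Module U L] [IsScalarTower ℂ U L]
    (B : Set (ℤ × ℤ × ℤ)) (v : Tableau) (hv : v.IsGeneric ∨ v.IsCritical)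
    (b : Module.Basis B ℂ L) (hb : IsTableauxBasis B v b) (hsimple : IsSimpleModule U L)
    (hinj : Function.Injective fun l : L => E21 • l) :
    (∀ x : ℂ, ∃ bD : Module.Basis (addN B) ℂ (D12x L x),
      IsTableauxBasis (addN B) (v.shift11 x) bD ∧
      (∀ w : B, bD ⟨w, mem_addN w.2⟩ = toTwist x (D12 L) (toD12 L (b w))) ∧
      ∀ K : Submodule U (D12x L x),
        (K : Set (D12x L x)) = Set.range (fun l : L => toTwist x (D12 L) (toD12 L l)) →
        ∃ bQ : Module.Basis (addN B \ B : Set (ℤ × ℤ × ℤ)) ℂ (D12x L x ⧸ K),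
          IsTableauxBasis (addN B \ B) (v.shift11 x) bQ ∧
          ∀ w : (addN B \ B : Set (ℤ × ℤ × ℤ)), bQ w = K.mkQ (bD ⟨w, w.2.1⟩)) ∧
    (∀ n : ℤ, ∃ φ : D12x L (n : ℂ) ≃ₗ[DU] D12 L,
      ∀ y : D12 L, ((unitE21 ^ n : DUˣ) : DU) • φ (toTwist (n : ℂ) (D12 L) y) = y) ∧
    (∃ bD : Module.Basis (addN B) ℂ (D12 L),
      IsTableauxBasis (addN B) v bD ∧
      (∀ w : B, bD ⟨w, mem_addN w.2⟩ = toD12 L (b w)) ∧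
      ∃ bQ : Module.Basis (addN B \ B : Set (ℤ × ℤ × ℤ)) ℂ (QD12 L),
        IsTableauxBasis (addN B \ B) v bQ ∧
        ∀ w : (addN B \ B : Set (ℤ × ℤ × ℤ)),
          bQ w = (LinearMap.range (toD12 L)).mkQ (bD ⟨w, w.2.1⟩)) := by
  have hB := hb.moveK_mem hv hinj
  obtain ⟨bD, hbD⟩ := exists_basis_D12 (fun w h => hb.E21_smul hv w h) hB hinj
  have hBA : B ⊆ addN B := fun w hw => mem_addN hw
  have hrange := range_toD12_eq_span hbD
  refine ⟨fun x => ?_, fun n => ?_, ?_⟩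
  · have h := isTableauxBasis_twist hv hsimple hinj hbD hB hb x
    refine ⟨bD.map (toTwist x (D12 L)), h, fun w => ?_, fun K hK => h.quotient hBA K ?_⟩
    · rw [Module.Basis.map_apply, basis_D12_of_mem hbD _ w.2]
    · have h1 : K.restrictScalars ℂ = ((LinearMap.range (toD12 L)).restrictScalars ℂ).map
          (toTwist x (D12 L)).toLinearMap := by
        apply SetLike.coe_injective
        refine hK.trans ?_
        ext y
        constructor
        · rintro ⟨l, rfl⟩; exact ⟨_, ⟨l, rfl⟩, rfl⟩
        · rintro ⟨_, ⟨l, rfl⟩, rfl⟩; exact ⟨l, rfl⟩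
      rw [h1, hrange, Submodule.map_span, ← Set.image_comp]
      rfl
  · refine ⟨twistIntEquiv L n, fun y => ?_⟩
    change fPow L n (fPow L (-n) y) = y
    rw [fPow_fPow, add_neg_cancel, fPow_zero]
  -- The untwisted statement is the case `x = 0`, as `Θ_0` is the identity.
  · have h := (isTableauxBasis_twist hv hsimple hinj hbD hB hb 0).map (twistZeroEquiv L)
    rw [shift11_zero] at h
    have h1 : (bD.map (toTwist 0 (D12 L))).map ((twistZeroEquiv L).restrictScalars ℂ) = bD := by
      ext1 w; rfl
    rw [h1] at h
    exact ⟨bD, h, fun w => basis_D12_of_mem hbD _ w.2, h.quotient hBA _ hrange⟩
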